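/- Let $(X_i)_{i\ge 1}$ and $(V_i)_{i\ge 1}$ be sequences of real random variables on a common probability space such that the sequence $(V_i)$ is independent of the sequence $(X_i)$ and $\mathbb E(V_i^2)<\infty$ for all $i$. Let $(X_i)$ be strictly stationary. Write $C^X(h)=\mathrm{Cov}(X_1,X_{1+h})$ for $h\ge 0$, write $v(i,j)=\mathrm{Cov}(V_i,V_j)$, and let $$\alpha(h)=\sup\{|\Pr(A\cap B)-\Pr(A)\Pr(B)| : s\ge 1,\ A\in\sigma(X_i : i\le s),\ B\in\sigma(X_i : i>s+h)\}$$ be the strong mixing coefficients of $(X_i)$. Suppose that: (i) $\mathbb E(X_i^8)<\infty$ for all $i$, and $\sum_{h\in\mathbb Z}|C^X(|h|)|<\infty$; (ii) $\sum_{i=1}^\infty \alpha(i)^{1/2}<\infty$; (iii) there is a constant $C\in\mathbb R$ with $|v(i,j)|\le C$ for all $i,j$; (iv) for every $\epsilon>0$ there are real numbers $n_{\epsilon,h}$, $h\ge 0$, such that $|1-v(i,i+h)|\le\epsilon$ for all $h$ with $C^X(h)\ne 0$ and all $i\ge n_{\epsilon,h}$, and $\lim_{n\to\infty}\frac1n\sum_{h=-n}^n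 n_{\epsilon,|h|}\,|C^X(|h|)|=0$; (v) for every $i$ the sum $C_i=\sum_{h\in\mathbb Z}|v(i,i+|h|)|$ is finite, and $\lim_{n\to\infty}\frac1{n^2}\sum_{i=1}^n C_i=0$. Then the limit $$\sigma_\infty^2=\lim_{n\to\infty}\mathrm{Var}\Bigl(\frac1{\sqrt n}\sum_{i=1}^n X_i\Bigr)\in\mathbb R$$ exists, and $$\mathrm{Var}\Bigl(\frac1{\sqrt n}\sum_{i=1}^n V_i\,(X_i-\mathbb E X_1)\,\Big|\,X_1,X_2,\dots\Bigr)\longrightarrow\sigma_\infty^2\quad\text{in probability as } n\to\infty .$$ -/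

import Mathlib

open MeasureTheory ProbabilityTheory Filter Topology

/-- Strict stationarity of a real-valued process: all finite-dimensional distributions are
invariant under time shifts. -/
def IsStrictlyStationary {Ω : Type*} [MeasurableSpace Ω] (X : ℕ → Ω → ℝ) (P : Measure Ω) : Prop :=
  ∀ (k : ℕ) (t : Fin k → ℕ) (τ : ℕ),
    P.map (fun ω (j : Fin k) => X (t j) ω) = P.map (fun ω (j : Fin k) => X (t j + τ) ω)

/-- The strong (`α`-) mixing coefficient of order `h`: the supremum of `|P(A ∩ B) - P(A) P(B)|`
over all times `s`, all `A ∈ σ(X i | i ≤ s)` and all `B ∈ σ(X i | i > s + h)`. -/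
noncomputable def alphaMixingCoeff {Ω : Type*} [MeasurableSpace Ω] (X : ℕ → Ω → ℝ)
    (P : Measure Ω) (h : ℕ) : ℝ :=
  sSup {r : ℝ | ∃ (s : ℕ) (A B : Set Ω),
    MeasurableSet[⨆ i ∈ Set.Iic s, MeasurableSpace.comap (X i) inferInstance] A ∧
    MeasurableSet[⨆ i ∈ Set.Ioi (s + h), MeasurableSpace.comap (X i) inferInstance] B ∧
    r = |P.real (A ∩ B) - P.real A * P.real B|}

/-- The autocovariance of lag `h` of a stationary process. -/
noncomputable def autocov {Ω : Type*} [MeasurableSpace Ω] (X : ℕ → Ω → ℝ) (P : Measure Ω)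
    (h : ℕ) : ℝ :=
  cov[X 0, X h; P]

/-- The bootstrap variance: the conditional variance, given the whole data sequence `X`, of the
centered and weighted normalized sum of the first `n` data points. -/
noncomputable def bootstrapVariance {Ω : Type*} [MeasurableSpace Ω] (X V : ℕ → Ω → ℝ)
    (P : Measure Ω) (n : ℕ) : Ω → ℝ :=
  condVar (MeasurableSpace.comap (fun ω i => X i ω) MeasurableSpace.pi)
    (fun ω => (√(n : ℝ))⁻¹ * ∑ i ∈ Finset.range n, V i ω * (X i ω - ∫ ω', X 0 ω' ∂P)) P

/-! Write `Y i` for the centered data and `Q_n(x) = n⁻¹ ∑ v(i,j) x_i x_j` with `v(i,j) = Cov(V_i,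
V_j)`. Independence of weights and data identifies the conditional variance with `Q_n(Y)` almost
surely (`condVar_weighted_sum`), so the claim is a law of large numbers for a quadratic form. It is
proved in `L¹`.

The mean of `Q_n(Y)` is an average of `v(i,j) C^X(|i-j|)` over a square. By dominated convergence
along the lags and Cesàro averaging it has the same limit as with all weights equal to one, which is
the long-run variance (`tendsto_weighted_average`).

For the fluctuations, let `a` be decreasing and summable with `a²` dominating the mixing
coefficients. For a bounded centered mixing process `U`, the covariance of `U i * U j` and `U k * U
l` is bounded by products of two values of `a` at distances between the indices, and these are
summable over `k` and `l` uniformly in `i` and `j` (`HasMixingBound.sum_abs_covariance_mul_mul_le`).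
Hence the variance of `Q_n(U)` is at most a constant times `n⁻² ∑ |v(i,j)|`, which tends to zero by
the row sum condition.

Unbounded data are truncated. The centered remainder `Z` satisfies `E Q_n(Z) ≤ B s` as soon as `s²`
bounds the fourth moment of the uncentered remainder (`HasMixingBound.integral_quadForm_le`),
uniformly in `n`. Since `Q_n` is positive semidefinite, a Cauchy–Schwarz type inequality
(`abs_quadForm_sub_le`) then shows that replacing `Y` by `Y - Z` changes `Q_n` little in mean. -/

/-! ### Mixing and covariances of bounded variables -/

/-- If the integrals of `g` over the sets of a sub-σ-algebra are bounded by `δ`, then so are, up to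
a factor, the integrals of `g` against bounded functions measurable for that σ-algebra. -/
theorem abs_integral_mul_le_of_forall_setIntegral {Ω : Type*} {m m0 : MeasurableSpace Ω}
    {P : Measure Ω} [IsProbabilityMeasure P] (hm : m ≤ m0) {f g : Ω → ℝ} {K δ : ℝ}
    (hg : Integrable g P) (hgδ : ∀ A, MeasurableSet[m] A → |∫ ω in A, g ω ∂P| ≤ δ)
    (hf : Measurable[m] f) (hfK : ∀ ω, |f ω| ≤ K) :
    |∫ ω, f ω * g ω ∂P| ≤ 2 * K * δ := by
  have hK : 0 ≤ K := by
    obtain ⟨ω⟩ : Nonempty Ω := nonempty_of_isProbabilityMeasure P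
    exact (abs_nonneg _).trans (hfK ω)
  set g' := P[g|m] with hg'
  have hg'm : StronglyMeasurable[m] g' := stronglyMeasurable_condExp
  have hg'i : Integrable g' P := integrable_condExp
  have hfs : StronglyMeasurable[m] f := hf.stronglyMeasurable
  have hfg : Integrable (f * g) P :=
    hg.bdd_mul (hfs.mono hm).aestronglyMeasurable (Eventually.of_forall hfK)
  have h1 : ∫ ω, f ω * g ω ∂P = ∫ ω, f ω * g' ω ∂P := by
    have h := condExp_mul_of_stronglyMeasurable_left (μ := P) hfs hfg hg
    rw [← integral_condExp hm (f := fun ω => f ω * g ω)]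
    exact integral_congr_ae h
  -- The conditional expectation of `g` has constant sign on `A` and on its complement, both in the
  -- sub-σ-algebra; each contributes at most `δ` to its `L¹` norm.
  set A : Set Ω := {ω | 0 ≤ g' ω} with hA
  have hAm : MeasurableSet[m] A := by
    exact @measurableSet_le _ _ _ _ _ m _ _ _ _ _ measurable_const hg'm.measurable
  have h2 : ∫ ω, |g' ω| ∂P ≤ 2 * δ := by
    rw [← integral_add_compl (hm _ hAm) hg'i.abs]
    have e1 : ∫ ω in A, |g' ω| ∂P = ∫ ω in A, g ω ∂P := by
      rw [← setIntegral_condExp hm hg hAm]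
      exact setIntegral_congr_fun (hm _ hAm) fun ω hω => abs_of_nonneg hω
    have e2 : ∫ ω in Aᶜ, |g' ω| ∂P = - ∫ ω in Aᶜ, g ω ∂P := by
      rw [← setIntegral_condExp hm hg hAm.compl, ← integral_neg]
      exact setIntegral_congr_fun (hm _ hAm.compl) fun ω hω => abs_of_neg (not_le.1 hω)
    rw [e1, e2]
    have := abs_le.1 (hgδ A hAm)
    have := abs_le.1 (hgδ Aᶜ hAm.compl)
    linarith
  rw [h1]
  calc |∫ ω, f ω * g' ω ∂P| ≤ ∫ ω, |f ω * g' ω| ∂P := abs_integral_le_integral_abs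
    _ ≤ ∫ ω, K * |g' ω| ∂P := by
        refine integral_mono_of_nonneg (Eventually.of_forall fun _ => abs_nonneg _)
          (hg'i.abs.const_mul K) (Eventually.of_forall fun ω => ?_)
        simp only [abs_mul]
        exact mul_le_mul_of_nonneg_right (hfK ω) (abs_nonneg _)
    _ = K * ∫ ω, |g' ω| ∂P := integral_const_mul _ _
    _ ≤ 2 * K * δ := by nlinarith

/-- The σ-algebra generated by the process up to time `s`. -/
abbrev pastSigma {Ω : Type*} (X : ℕ → Ω → ℝ) (s : ℕ) : MeasurableSpace Ω :=
  ⨆ i ∈ Set.Iic s, MeasurableSpace.comap (X i) inferInstance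

/-- The σ-algebra generated by the process from time `s` on. -/
abbrev futureSigma {Ω : Type*} (X : ℕ → Ω → ℝ) (s : ℕ) : MeasurableSpace Ω :=
  ⨆ i ∈ Set.Ici s, MeasurableSpace.comap (X i) inferInstance

/-- The dependence between the past and the future at distance `m` is at most `a m ^ 2`. -/
def HasMixingBound {Ω : Type*} [MeasurableSpace Ω] (X : ℕ → Ω → ℝ) (P : Measure Ω)
    (a : ℕ → ℝ) : Prop :=
  ∀ (m s : ℕ) (A B : Set Ω), MeasurableSet[pastSigma X s] A →
    MeasurableSet[futureSigma X (s + m)] B → |P.real (A ∩ B) - P.real A * P.real B| ≤ a m ^ 2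

theorem measurable_pastSigma {Ω : Type*} {X : ℕ → Ω → ℝ} {i s : ℕ} (h : i ≤ s) :
    Measurable[pastSigma X s] (X i) :=
  (comap_measurable (X i)).mono
    (le_iSup₂ (f := fun i (_ : i ∈ Set.Iic s) => MeasurableSpace.comap (X i) inferInstance) i h)
    le_rfl

theorem measurable_futureSigma {Ω : Type*} {X : ℕ → Ω → ℝ} {i s : ℕ} (h : s ≤ i) :
    Measurable[futureSigma X s] (X i) :=
  (comap_measurable (X i)).mono
    (le_iSup₂ (f := fun i (_ : i ∈ Set.Ici s) => MeasurableSpace.comap (X i) inferInstance) i h)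
    le_rfl

section Mixing

variable {Ω : Type*} [mΩ : MeasurableSpace Ω] {X : ℕ → Ω → ℝ} {P : Measure Ω}

theorem pastSigma_le (hX : ∀ i, Measurable (X i)) (s : ℕ) : pastSigma X s ≤ mΩ :=
  iSup₂_le fun i _ => (hX i).comap_le

theorem futureSigma_le (hX : ∀ i, Measurable (X i)) (s : ℕ) : futureSigma X s ≤ mΩ :=
  iSup₂_le fun i _ => (hX i).comap_le

variable [IsProbabilityMeasure P]

/-- Two applications of the preceding bound pass from events to functions, first for `f` with `B`
fixed (tested against the centered indicator of `B`), then for `g` tested against the centered `f`.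
Each costs a factor 2. -/
theorem HasMixingBound.abs_integral_sub_le {a : ℕ → ℝ} (h : HasMixingBound X P a)
    (hX : ∀ i, Measurable (X i)) {m s : ℕ} {f g : Ω → ℝ} {K L : ℝ}
    (hf : Measurable[pastSigma X s] f) (hg : Measurable[futureSigma X (s + m)] g)
    (hfK : ∀ ω, |f ω| ≤ K) (hgL : ∀ ω, |g ω| ≤ L) :
    |∫ ω, f ω * g ω ∂P - (∫ ω, f ω ∂P) * ∫ ω, g ω ∂P| ≤ 4 * K * L * a m ^ 2 := by
  have hp := pastSigma_le hX s
  have hq := futureSigma_le hX (s + m)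
  have hfm : Measurable f := hf.mono hp le_rfl
  have hgm : Measurable g := hg.mono hq le_rfl
  have hfi : Integrable f P := Integrable.of_bound hfm.aestronglyMeasurable K
    (Eventually.of_forall hfK)
  have hgi : Integrable g P := Integrable.of_bound hgm.aestronglyMeasurable L
    (Eventually.of_forall hgL)
  have hfgi : Integrable (fun ω => f ω * g ω) P :=
    hgi.bdd_mul hfm.aestronglyMeasurable (Eventually.of_forall hfK)
  have key : ∀ B, MeasurableSet[futureSigma X (s + m)] B →
      |∫ ω in B, (f ω - ∫ ω, f ω ∂P) ∂P| ≤ 2 * K * a m ^ 2 := by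
    intro B hB
    have hB' := hq _ hB
    have hi : Integrable (fun ω => B.indicator (fun _ => (1 : ℝ)) ω - P.real B) P :=
      ((integrable_const _).indicator hB').sub (integrable_const _)
    have h1 := abs_integral_mul_le_of_forall_setIntegral (P := P) hp
      (g := fun ω => B.indicator (fun _ => (1 : ℝ)) ω - P.real B) (δ := a m ^ 2) hi (fun A hA => by
        have hA' := hp _ hA
        have hiA : Integrable (fun ω => B.indicator (fun _ => (1 : ℝ)) ω) (P.restrict A) :=
          ((integrable_const (1 : ℝ)).indicator hB').integrableOn
        rw [integral_sub hiA (integrable_const _), setIntegral_indicator hB']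
        simpa using h m s A B hA hB) hf hfK
    refine le_of_eq_of_le ?_ h1
    congr 1
    rw [integral_sub hfi.integrableOn (integrable_const _)]
    simp only [mul_sub]
    rw [integral_sub _ (hfi.mul_const _), integral_mul_const, ← integral_indicator hB']
    · simp only [integral_const, smul_eq_mul, measureReal_restrict_apply_univ]
      rw [mul_comm]
      congr 2
      ext ω
      by_cases hω : ω ∈ B <;> simp [hω]
    · exact ((integrable_const (1 : ℝ)).indicator hB').bdd_mul hfm.aestronglyMeasurable
        (Eventually.of_forall hfK)
  have h2 := abs_integral_mul_le_of_forall_setIntegral (P := P) hq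
    (hfi.sub (integrable_const _)) key hg hgL
  refine (le_of_eq_of_le ?_ h2).trans_eq (by ring)
  congr 1
  simp only [Pi.sub_apply, mul_sub]
  rw [integral_sub (by simpa only [mul_comm] using hfgi) (hgi.mul_const _), integral_mul_const]
  simp only [mul_comm]

end Mixing

theorem HasMixingBound.comp {Ω : Type*} [MeasurableSpace Ω] {X : ℕ → Ω → ℝ} {P : Measure Ω}
    {a : ℕ → ℝ} (h : HasMixingBound X P a) {φ : ℝ → ℝ} (hφ : Measurable φ) :
    HasMixingBound (fun i ω => φ (X i ω)) P a := by
  have hle : ∀ i, MeasurableSpace.comap (fun ω => φ (X i ω)) inferInstance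
      ≤ MeasurableSpace.comap (X i) inferInstance := fun i =>
    (hφ.comp (comap_measurable (X i))).comap_le
  intro m s A B hA hB
  exact h m s A B (iSup₂_mono (fun i _ => hle i) _ hA) (iSup₂_mono (fun i _ => hle i) _ hB)

/-! ### Covariances of products of bounded mixing variables -/

/-- A variable whose index is at distance at least `m` from `l` is a product of a variable from
the past before `l - m` and a variable from the future after `l + m`. -/
theorem exists_past_mul_future {Ω : Type*} {U : ℕ → Ω → ℝ} {K : ℝ} (hK1 : 1 ≤ K)
    (hK : ∀ i ω, |U i ω| ≤ K) {m l p : ℕ} (hp : p + m ≤ l ∨ l + m ≤ p) :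
    ∃ f g : Ω → ℝ, (∀ ω, U p ω = f ω * g ω) ∧ Measurable[pastSigma U (l - m)] f ∧
      (l < m → f = fun _ => 1) ∧ Measurable[futureSigma U (l + m)] g ∧
      (∀ ω, |f ω| ≤ K) ∧ ∀ ω, |g ω| ≤ K := by
  rcases hp with hp | hp
  · exact ⟨U p, fun _ => 1, by simp, measurable_pastSigma (by omega), by omega,
      measurable_const, hK p, by simp [hK1]⟩
  · exact ⟨fun _ => 1, U p, by simp, measurable_const, fun _ => rfl,
      measurable_futureSigma hp, by simp [hK1], hK p⟩

theorem abs_mul_mul_le {x y z K : ℝ} (hx : |x| ≤ K) (hy : |y| ≤ K) (hz : |z| ≤ K) :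
    |x * y * z| ≤ K * K * K := by
  have hK := (abs_nonneg x).trans hx
  rw [abs_mul, abs_mul]
  gcongr

section FourthMoments

variable {Ω : Type*} [mΩ : MeasurableSpace Ω] {P : Measure Ω} [IsProbabilityMeasure P]
  {U : ℕ → Ω → ℝ} {a : ℕ → ℝ} {K : ℝ}

theorem HasMixingBound.abs_integral_mul_le (h : HasMixingBound U P a) (hU : ∀ i, Measurable (U i))
    (hK : ∀ i ω, |U i ω| ≤ K) (h0 : ∀ i, ∫ ω, U i ω ∂P = 0) {m k l : ℕ}
    (hkl : k + m ≤ l ∨ l + m ≤ k) : |∫ ω, U k ω * U l ω ∂P| ≤ 4 * K * K * a m ^ 2 := by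
  rcases hkl with hkl | hkl
  · simpa [h0] using h.abs_integral_sub_le hU (measurable_pastSigma le_rfl)
      (measurable_futureSigma hkl) (hK k) (hK l)
  · simpa [h0, mul_comm] using h.abs_integral_sub_le hU (measurable_pastSigma le_rfl)
      (measurable_futureSigma hkl) (hK l) (hK k)

/-- The three other factors split into a past part `f` and a future part `g`. Mixing first decouples
`f * U l` from `g`, then `U l` from `f`, and `U l` has mean zero. -/
theorem HasMixingBound.abs_integral_mul_le_of_isolated (h : HasMixingBound U P a)
    (hU : ∀ i, Measurable (U i)) (hK1 : 1 ≤ K)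
    (hK : ∀ i ω, |U i ω| ≤ K) (h0 : ∀ i, ∫ ω, U i ω ∂P = 0) {m l p q r : ℕ}
    (hp : p + m ≤ l ∨ l + m ≤ p) (hq : q + m ≤ l ∨ l + m ≤ q) (hr : r + m ≤ l ∨ l + m ≤ r) :
    |∫ ω, U l ω * (U p ω * U q ω * U r ω) ∂P| ≤ 8 * K ^ 7 * a m ^ 2 := by
  obtain ⟨f₁, g₁, e₁, fm₁, fo₁, gm₁, fb₁, gb₁⟩ := exists_past_mul_future hK1 hK hp
  obtain ⟨f₂, g₂, e₂, fm₂, fo₂, gm₂, fb₂, gb₂⟩ := exists_past_mul_future hK1 hK hq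
  obtain ⟨f₃, g₃, e₃, fm₃, fo₃, gm₃, fb₃, gb₃⟩ := exists_past_mul_future hK1 hK hr
  have hK0 : 0 ≤ K := zero_le_one.trans hK1
  set f : Ω → ℝ := fun ω => f₁ ω * f₂ ω * f₃ ω with hf
  set g : Ω → ℝ := fun ω => g₁ ω * g₂ ω * g₃ ω with hg
  have hfm : Measurable[pastSigma U (l - m)] f := (fm₁.mul fm₂).mul fm₃
  have hgm : Measurable[futureSigma U (l + m)] g := (gm₁.mul gm₂).mul gm₃
  have hfb : ∀ ω, |f ω| ≤ K * K * K := fun ω => abs_mul_mul_le (fb₁ ω) (fb₂ ω) (fb₃ ω)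
  have hgb : ∀ ω, |g ω| ≤ K * K * K := fun ω => abs_mul_mul_le (gb₁ ω) (gb₂ ω) (gb₃ ω)
  have hfl : Measurable[pastSigma U l] (fun ω => f ω * U l ω) :=
    (hfm.mono (biSup_mono fun i hi => le_trans (Set.mem_Iic.1 hi) (Nat.sub_le l m)) le_rfl).mul
      (measurable_pastSigma le_rfl)
  have hflb : ∀ ω, |f ω * U l ω| ≤ K * K * K * K := fun ω => by
    rw [abs_mul]
    exact mul_le_mul (hfb ω) (hK l ω) (abs_nonneg _) (by positivity)
  have s1 := h.abs_integral_sub_le hU hfl hgm hflb hgb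
  have s2 : |∫ ω, f ω * U l ω ∂P| ≤ 4 * (K * K * K) * K * a m ^ 2 := by
    -- Here `l - m` truncates to zero, which gives no gap of length `m`; but then no index lies in
    -- the past and the mean of `U l` alone is zero.
    by_cases hlm : l < m
    · have : f = fun _ => 1 := by simp [hf, fo₁ hlm, fo₂ hlm, fo₃ hlm]
      simp only [this, one_mul, h0, abs_zero]
      positivity
    · simpa [h0] using h.abs_integral_sub_le hU hfm
        (measurable_futureSigma (X := U) (i := l) (by omega)) hfb (hK l)
  have s3 : |∫ ω, g ω ∂P| ≤ K * K * K := by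
    simpa using norm_integral_le_of_norm_le_const (μ := P) (f := g) (Eventually.of_forall hgb)
  have e : ∫ ω, U l ω * (U p ω * U q ω * U r ω) ∂P = ∫ ω, f ω * U l ω * g ω ∂P := by
    refine integral_congr_ae (Eventually.of_forall fun ω => ?_)
    simp only [e₁, e₂, e₃, hf, hg]
    ring
  rw [e]
  calc |∫ ω, f ω * U l ω * g ω ∂P|
      ≤ |∫ ω, f ω * U l ω * g ω ∂P - (∫ ω, f ω * U l ω ∂P) * ∫ ω, g ω ∂P|
        + |∫ ω, f ω * U l ω ∂P| * |∫ ω, g ω ∂P| := by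
        rw [← abs_mul]
        exact (abs_add_le _ _).trans_eq' (by ring_nf)
    _ ≤ 4 * (K * K * K * K) * (K * K * K) * a m ^ 2
        + 4 * (K * K * K) * K * a m ^ 2 * (K * K * K) := by
        gcongr
    _ = 8 * K ^ 7 * a m ^ 2 := by ring

theorem memLp_mul_of_bounded (hU : ∀ i, Measurable (U i)) (hK : ∀ i ω, |U i ω| ≤ K) (i j : ℕ) :
    MemLp (fun ω => U i ω * U j ω) 2 P := by
  refine MemLp.of_bound ((hU i).mul (hU j)).aestronglyMeasurable (K * K)
    (Eventually.of_forall fun ω => ?_)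
  rw [Real.norm_eq_abs, abs_mul]
  exact mul_le_mul (hK i ω) (hK j ω) (abs_nonneg _) ((abs_nonneg _).trans (hK i ω))

theorem covariance_mul_mul_eq (hU : ∀ i, Measurable (U i)) (hK : ∀ i ω, |U i ω| ≤ K)
    (i j k l : ℕ) :
    cov[fun ω => U i ω * U j ω, fun ω => U k ω * U l ω; P] =
      ∫ ω, U i ω * U j ω * (U k ω * U l ω) ∂P
        - (∫ ω, U i ω * U j ω ∂P) * ∫ ω, U k ω * U l ω ∂P :=
  covariance_eq_sub (memLp_mul_of_bounded hU hK i j) (memLp_mul_of_bounded hU hK k l)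

theorem abs_integral_mul_le_of_bounded (hK : ∀ i ω, |U i ω| ≤ K) (i j : ℕ) :
    |∫ ω, U i ω * U j ω ∂P| ≤ K * K := by
  have h : ∀ ω, ‖U i ω * U j ω‖ ≤ K * K := fun ω => by
    rw [Real.norm_eq_abs, abs_mul]
    exact mul_le_mul (hK i ω) (hK j ω) (abs_nonneg _) ((abs_nonneg _).trans (hK i ω))
  simpa using norm_integral_le_of_norm_le_const (μ := P) (Eventually.of_forall h)

theorem HasMixingBound.abs_covariance_mul_mul_le_of_isolated (h : HasMixingBound U P a)
    (hU : ∀ i, Measurable (U i)) (hK1 : 1 ≤ K)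
    (hK : ∀ i ω, |U i ω| ≤ K) (h0 : ∀ i, ∫ ω, U i ω ∂P = 0) {m i j k l : ℕ}
    (hj : j + m ≤ i ∨ i + m ≤ j) (hk : k + m ≤ i ∨ i + m ≤ k) (hl : l + m ≤ i ∨ i + m ≤ l) :
    |cov[fun ω => U i ω * U j ω, fun ω => U k ω * U l ω; P]| ≤ 12 * K ^ 7 * a m ^ 2 := by
  have h1 := h.abs_integral_mul_le_of_isolated hU hK1 hK h0 hj hk hl
  have h2 := h.abs_integral_mul_le hU hK h0 hj.symm
  have h3 := abs_integral_mul_le_of_bounded (P := P) hK k l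
  rw [covariance_mul_mul_eq hU hK]
  have e : ∫ ω, U i ω * U j ω * (U k ω * U l ω) ∂P
      = ∫ ω, U i ω * (U j ω * U k ω * U l ω) ∂P := by simp only [mul_assoc]
  have hK0 : 0 ≤ K := zero_le_one.trans hK1
  have hK47 : K ^ 4 ≤ K ^ 7 := pow_le_pow_right₀ hK1 (by norm_num)
  rw [e]
  calc _ ≤ |∫ ω, U i ω * (U j ω * U k ω * U l ω) ∂P|
        + |(∫ ω, U i ω * U j ω ∂P)| * |∫ ω, U k ω * U l ω ∂P| := by
        rw [← abs_mul]
        exact abs_sub _ _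
    _ ≤ 8 * K ^ 7 * a m ^ 2 + 4 * K * K * a m ^ 2 * (K * K) := by gcongr
    _ = 8 * K ^ 7 * a m ^ 2 + 4 * K ^ 4 * a m ^ 2 := by ring
    _ ≤ 8 * K ^ 7 * a m ^ 2 + 4 * K ^ 7 * a m ^ 2 := by gcongr
    _ = 12 * K ^ 7 * a m ^ 2 := by ring

theorem HasMixingBound.abs_covariance_mul_mul_le_of_lt (h : HasMixingBound U P a)
    (hU : ∀ i, Measurable (U i)) (hK1 : 1 ≤ K) (hK : ∀ i ω, |U i ω| ≤ K) {m i j k l : ℕ}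
    (hik : i + m ≤ k) (hil : i + m ≤ l) (hjk : j + m ≤ k) (hjl : j + m ≤ l) :
    |cov[fun ω => U i ω * U j ω, fun ω => U k ω * U l ω; P]| ≤ 12 * K ^ 7 * a m ^ 2 := by
  rw [covariance_mul_mul_eq hU hK]
  have hK0 : 0 ≤ K := zero_le_one.trans hK1
  have hK47 : K ^ 4 ≤ K ^ 7 := pow_le_pow_right₀ hK1 (by norm_num)
  have hb : ∀ i j ω, |U i ω * U j ω| ≤ K * K := fun i j ω => by
    rw [abs_mul]
    exact mul_le_mul (hK i ω) (hK j ω) (abs_nonneg _) hK0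
  refine (h.abs_integral_sub_le hU (s := max i j) (m := m)
    ((measurable_pastSigma (le_max_left i j)).mul (measurable_pastSigma (le_max_right i j)))
    ((measurable_futureSigma (by omega)).mul (measurable_futureSigma (by omega)))
    (hb i j) (hb k l)).trans ?_
  calc 4 * (K * K) * (K * K) * a m ^ 2 = 4 * K ^ 4 * a m ^ 2 := by ring
    _ ≤ 12 * K ^ 7 * a m ^ 2 := by gcongr; norm_num

/-- Either one pair lies entirely before the other with a gap `m`, or the pairs interlace or nest.
In the latter case the smallest of the four indices is at distance at least `m` from the other
three. -/
theorem HasMixingBound.abs_covariance_mul_mul_le_of_separated (h : HasMixingBound U P a)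
    (hU : ∀ i, Measurable (U i)) (hK1 : 1 ≤ K)
    (hK : ∀ i ω, |U i ω| ≤ K) (h0 : ∀ i, ∫ ω, U i ω ∂P = 0) {m i j k l : ℕ}
    (hik : k + m ≤ i ∨ i + m ≤ k) (hil : l + m ≤ i ∨ i + m ≤ l)
    (hjk : k + m ≤ j ∨ j + m ≤ k) (hjl : l + m ≤ j ∨ j + m ≤ l) :
    |cov[fun ω => U i ω * U j ω, fun ω => U k ω * U l ω; P]| ≤ 12 * K ^ 7 * a m ^ 2 := by
  wlog hij : i ≤ j generalizing i j
  · simpa only [mul_comm (U j _)] using this hjk hjl hik hil (le_of_not_ge hij)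
  wlog hkl : k ≤ l generalizing k l
  · simpa only [mul_comm (U l _)] using this hil hik hjl hjk (le_of_not_ge hkl)
  by_cases h1 : l + m ≤ i
  · rw [covariance_comm]
    exact h.abs_covariance_mul_mul_le_of_lt hU hK1 hK (by omega) (by omega) (by omega) (by omega)
  by_cases h2 : j + m ≤ k
  · exact h.abs_covariance_mul_mul_le_of_lt hU hK1 hK (by omega) (by omega) (by omega) (by omega)
  by_cases h3 : k + m ≤ i
  · rw [covariance_comm]
    exact h.abs_covariance_mul_mul_le_of_isolated hU hK1 hK h0 (by omega) (by omega) (by omega)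
  · exact h.abs_covariance_mul_mul_le_of_isolated hU hK1 hK h0 (by omega) (by omega) (by omega)

/-- The larger of the two gaps gives the square of the smaller of `a m` and `a n`: isolation of `l`
if `m ≤ n`, separation of the pairs otherwise. The weaker product form is kept because it can be
summed over `l` and then over `k`. -/
theorem HasMixingBound.abs_covariance_mul_mul_le_mul (h : HasMixingBound U P a)
    (hU : ∀ i, Measurable (U i)) (hK1 : 1 ≤ K)
    (hK : ∀ i ω, |U i ω| ≤ K) (h0 : ∀ i, ∫ ω, U i ω ∂P = 0) (ha : Antitone a) (ha0 : ∀ m, 0 ≤ a m)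
    {m n i j k l : ℕ} (hki : m ≤ Nat.dist k i) (hkj : m ≤ Nat.dist k j) (hli : m ≤ Nat.dist l i)
    (hlj : m ≤ Nat.dist l j) (hli' : n ≤ Nat.dist l i) (hlj' : n ≤ Nat.dist l j)
    (hlk : n ≤ Nat.dist l k) :
    |cov[fun ω => U i ω * U j ω, fun ω => U k ω * U l ω; P]| ≤ 12 * K ^ 7 * (a m * a n) := by
  have hK0 : 0 ≤ K := zero_le_one.trans hK1
  unfold Nat.dist at *
  rcases le_total m n with hmn | hmn
  · have key := h.abs_covariance_mul_mul_le_of_isolated hU hK1 hK h0 (m := n) (i := l) (j := k)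
      (k := i) (l := j) (by omega) (by omega) (by omega)
    rw [covariance_comm]
    simp only [mul_comm (U k _)]
    refine key.trans ?_
    rw [sq]
    have := ha hmn
    have := ha0 n
    gcongr
  · refine (h.abs_covariance_mul_mul_le_of_separated hU hK1 hK h0 (m := m)
      (by omega) (by omega) (by omega) (by omega)).trans ?_
    rw [sq]
    have := ha hmn
    have := ha0 m
    gcongr

theorem apply_min_le_add {a : ℕ → ℝ} (ha0 : ∀ m, 0 ≤ a m) (x y : ℕ) : a (min x y) ≤ a x + a y := by
  have := ha0 x
  have := ha0 y
  rcases min_choice x y with h | h <;> rw [h] <;> linarith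

/-- The two summands correspond to which of `k` and `l` is closer to `{i, j}`. The closer one
provides the gap `m` between the pairs, the other one the gap `n` to all remaining indices. -/
theorem HasMixingBound.abs_covariance_mul_mul_le (h : HasMixingBound U P a)
    (hU : ∀ i, Measurable (U i)) (hK1 : 1 ≤ K)
    (hK : ∀ i ω, |U i ω| ≤ K) (h0 : ∀ i, ∫ ω, U i ω ∂P = 0) (ha : Antitone a) (ha0 : ∀ m, 0 ≤ a m)
    (i j k l : ℕ) :
    |cov[fun ω => U i ω * U j ω, fun ω => U k ω * U l ω; P]| ≤ 12 * K ^ 7 *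
      ((a (Nat.dist k i) + a (Nat.dist k j)) *
          (a (Nat.dist l i) + a (Nat.dist l j) + a (Nat.dist l k)) +
        (a (Nat.dist l i) + a (Nat.dist l j)) *
          (a (Nat.dist k i) + a (Nat.dist k j) + a (Nat.dist k l))) := by
  have hK0 : 0 ≤ K := zero_le_one.trans hK1
  have key : ∀ k l : ℕ, min (Nat.dist k i) (Nat.dist k j) ≤ min (Nat.dist l i) (Nat.dist l j) →
      |cov[fun ω => U i ω * U j ω, fun ω => U k ω * U l ω; P]| ≤ 12 * K ^ 7 *
      ((a (Nat.dist k i) + a (Nat.dist k j)) *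
          (a (Nat.dist l i) + a (Nat.dist l j) + a (Nat.dist l k))) := by
    intro k l hle
    refine (h.abs_covariance_mul_mul_le_mul hU hK1 hK h0 ha ha0
      (m := min (Nat.dist k i) (Nat.dist k j))
      (n := min (min (Nat.dist l i) (Nat.dist l j)) (Nat.dist l k))
      (by omega) (by omega) (by omega) (by omega) (by omega) (by omega) (by omega)).trans ?_
    have h1 := apply_min_le_add ha0 (Nat.dist k i) (Nat.dist k j)
    have h2 := apply_min_le_add ha0 (min (Nat.dist l i) (Nat.dist l j)) (Nat.dist l k)
    have h3 := apply_min_le_add ha0 (Nat.dist l i) (Nat.dist l j)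
    have h4 := ha0 (Nat.dist k i)
    have h5 := ha0 (Nat.dist k j)
    have h6 := ha0 (min (min (Nat.dist l i) (Nat.dist l j)) (Nat.dist l k))
    gcongr
    linarith
  have n1 := ha0 (Nat.dist k i)
  have n2 := ha0 (Nat.dist k j)
  have n3 := ha0 (Nat.dist l i)
  have n4 := ha0 (Nat.dist l j)
  have n5 := ha0 (Nat.dist l k)
  have n6 := ha0 (Nat.dist k l)
  rcases le_total (min (Nat.dist k i) (Nat.dist k j)) (min (Nat.dist l i) (Nat.dist l j))
    with hm | hm
  · refine (key k l hm).trans ?_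
    gcongr
    exact le_add_of_nonneg_right (by positivity)
  · have := key l k hm
    simp only [mul_comm (U l _)] at this
    refine this.trans ?_
    gcongr
    exact le_add_of_nonneg_left (by positivity)

theorem sum_range_dist_le {a : ℕ → ℝ} (ha0 : ∀ m, 0 ≤ a m) (hs : Summable a) (n q : ℕ) :
    ∑ k ∈ Finset.range n, a (Nat.dist k q) ≤ 2 * ∑' m, a m := by
  have hle : ∀ k, a (Nat.dist k q) ≤
      (if q ≤ k then a (k - q) else 0) + (if k ≤ q then a (q - k) else 0) := by
    intro k
    have := ha0 (k - q)
    have := ha0 (q - k)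
    rcases le_total k q with h | h
    · rw [Nat.dist_eq_sub_of_le h, if_pos h]
      split_ifs <;> linarith
    · rw [Nat.dist_eq_sub_of_le_right h, if_pos h]
      split_ifs <;> linarith
  refine (Finset.sum_le_sum fun k _ => hle k).trans ?_
  rw [Finset.sum_add_distrib, two_mul, ← Finset.sum_filter, ← Finset.sum_filter]
  refine add_le_add ?_ ?_
  · rw [← Finset.sum_image (g := fun k => k - q) (f := a)]
    · exact hs.sum_le_tsum _ fun i _ => ha0 i
    · intro x hx y hy hxy
      simp at hx hy hxy
      omega
  · rw [← Finset.sum_image (g := fun k => q - k) (f := a)]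
    · exact hs.sum_le_tsum _ fun i _ => ha0 i
    · intro x hx y hy hxy
      simp at hx hy hxy
      omega

/-- Each sum of `a` over distances to a fixed index is at most `2 A`. Summing over `l` first removes
the dependence on `k`, so each summand gives `4 A * 6 A`; the bound is uniform in `i`, `j` and `n`.
-/
theorem HasMixingBound.sum_abs_covariance_mul_mul_le (h : HasMixingBound U P a)
    (hU : ∀ i, Measurable (U i)) (hK1 : 1 ≤ K)
    (hK : ∀ i ω, |U i ω| ≤ K) (h0 : ∀ i, ∫ ω, U i ω ∂P = 0) (ha : Antitone a) (ha0 : ∀ m, 0 ≤ a m)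
    (hs : Summable a) (i j n : ℕ) :
    ∑ k ∈ Finset.range n, ∑ l ∈ Finset.range n,
      |cov[fun ω => U i ω * U j ω, fun ω => U k ω * U l ω; P]| ≤
        576 * K ^ 7 * (∑' m, a m) ^ 2 := by
  have hK0 : 0 ≤ K := zero_le_one.trans hK1
  set A := ∑' m, a m with hA
  have hA0 : 0 ≤ A := tsum_nonneg ha0
  have key : ∑ k ∈ Finset.range n, ∑ l ∈ Finset.range n,
      (a (Nat.dist k i) + a (Nat.dist k j)) *
          (a (Nat.dist l i) + a (Nat.dist l j) + a (Nat.dist l k)) ≤ 24 * A ^ 2 := by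
    calc _ ≤ ∑ k ∈ Finset.range n, (a (Nat.dist k i) + a (Nat.dist k j)) * (6 * A) := by
          refine Finset.sum_le_sum fun k _ => ?_
          rw [← Finset.mul_sum]
          refine mul_le_mul_of_nonneg_left ?_ (add_nonneg (ha0 _) (ha0 _))
          rw [Finset.sum_add_distrib, Finset.sum_add_distrib]
          have := sum_range_dist_le ha0 hs n i
          have := sum_range_dist_le ha0 hs n j
          have := sum_range_dist_le ha0 hs n k
          linarith
      _ ≤ (4 * A) * (6 * A) := by
          rw [← Finset.sum_mul]
          refine mul_le_mul_of_nonneg_right ?_ (by positivity)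
          rw [Finset.sum_add_distrib]
          have := sum_range_dist_le ha0 hs n i
          have := sum_range_dist_le ha0 hs n j
          linarith
      _ = 24 * A ^ 2 := by ring
  have key' := key
  rw [Finset.sum_comm] at key'
  calc _ ≤ ∑ k ∈ Finset.range n, ∑ l ∈ Finset.range n, 12 * K ^ 7 *
      ((a (Nat.dist k i) + a (Nat.dist k j)) *
          (a (Nat.dist l i) + a (Nat.dist l j) + a (Nat.dist l k)) +
        (a (Nat.dist l i) + a (Nat.dist l j)) *
          (a (Nat.dist k i) + a (Nat.dist k j) + a (Nat.dist k l))) :=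
        Finset.sum_le_sum fun k _ => Finset.sum_le_sum fun l _ =>
          h.abs_covariance_mul_mul_le hU hK1 hK h0 ha ha0 i j k l
    _ ≤ 12 * K ^ 7 * (24 * A ^ 2 + 24 * A ^ 2) := by
        simp_rw [← Finset.mul_sum, Finset.sum_add_distrib]
        exact mul_le_mul_of_nonneg_left (add_le_add key key') (by positivity)
    _ = 576 * K ^ 7 * A ^ 2 := by ring

end FourthMoments

/-! ### Truncation and covariances under fourth moments -/

/-- Truncation of a real number to the interval `[-L, L]`. -/
noncomputable def truncate (L x : ℝ) : ℝ := max (-L) (min x L)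

theorem measurable_truncate (L : ℝ) : Measurable (truncate L) := by
  unfold truncate
  fun_prop

theorem abs_truncate_le {L : ℝ} (hL : 0 ≤ L) (x : ℝ) : |truncate L x| ≤ L := by
  unfold truncate
  rw [abs_le]
  exact ⟨le_max_left _ _, max_le (by linarith) (min_le_right _ _)⟩

theorem truncate_of_abs_le {L x : ℝ} (h : |x| ≤ L) : truncate L x = x := by
  rw [abs_le] at h
  rw [truncate, min_eq_left h.2, max_eq_right h.1]

theorem abs_sub_truncate_le {L : ℝ} (hL : 0 ≤ L) (x : ℝ) : |x - truncate L x| ≤ |x| := by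
  rcases le_or_gt |x| L with h | h
  · simp [truncate_of_abs_le h]
  · unfold truncate
    rcases lt_abs.1 h with h | h
    · rw [min_eq_right h.le, max_eq_right (by linarith), abs_of_nonneg, abs_of_nonneg] <;> linarith
    · rw [min_eq_left (by linarith), max_eq_left (by linarith), abs_of_nonpos, abs_of_nonpos]
        <;> linarith

theorem abs_sub_truncate_le_pow {L : ℝ} (hL : 0 < L) (x : ℝ) :
    |x - truncate L x| ≤ x ^ 4 / L ^ 3 := by
  rcases le_or_gt |x| L with h | h
  · rw [truncate_of_abs_le h, sub_self, abs_zero]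
    positivity
  · refine (abs_sub_truncate_le hL.le x).trans ?_
    rw [le_div_iff₀ (by positivity), ← Even.pow_abs (by decide : Even 4), pow_succ' |x| 3]
    gcongr

theorem sub_truncate_sq_le_pow {L : ℝ} (hL : 0 < L) (x : ℝ) :
    (x - truncate L x) ^ 2 ≤ x ^ 4 / L ^ 2 := by
  rcases le_or_gt |x| L with h | h
  · rw [truncate_of_abs_le h, sub_self, zero_pow two_ne_zero]
    positivity
  · rw [← sq_abs]
    have h1 := abs_sub_truncate_le hL.le x
    rw [le_div_iff₀ (by positivity), ← Even.pow_abs (by decide : Even 4)]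
    calc |x - truncate L x| ^ 2 * L ^ 2 ≤ |x| ^ 2 * |x| ^ 2 := by gcongr
      _ = |x| ^ 4 := by ring

theorem integrable_pow_four {Ω : Type*} [MeasurableSpace Ω] {P : Measure Ω} {f : Ω → ℝ}
    (hf : MemLp f 4 P) : Integrable (fun ω => f ω ^ 4) P := by
  have h := hf.integrable_norm_pow (by norm_num)
  simpa [Even.pow_abs (by decide : Even 4)] using h

section Covariance

variable {Ω : Type*} [mΩ : MeasurableSpace Ω] {P : Measure Ω} [IsProbabilityMeasure P]
  {f g : Ω → ℝ}

theorem abs_covariance_le_half (hf : MemLp f 2 P) (hg : MemLp g 2 P) :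
    |cov[f, g; P]| ≤ (∫ ω, f ω ^ 2 ∂P + ∫ ω, g ω ^ 2 ∂P) / 2 := by
  have hf' : MemLp (fun ω => f ω - ∫ x, f x ∂P) 2 P := hf.sub (memLp_const (∫ ω, f ω ∂P))
  have hg' : MemLp (fun ω => g ω - ∫ x, g x ∂P) 2 P := hg.sub (memLp_const (∫ ω, g ω ∂P))
  have h1 : |cov[f, g; P]| ≤ (Var[f; P] + Var[g; P]) / 2 := by
    rw [variance_eq_integral hf.aemeasurable, variance_eq_integral hg.aemeasurable,
      ← integral_add hf'.integrable_sq hg'.integrable_sq, ← integral_div]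
    refine abs_integral_le_integral_abs.trans (integral_mono (hf'.integrable_mul hg').abs
      ((hf'.integrable_sq.add hg'.integrable_sq).div_const 2) fun ω => ?_)
    rw [abs_le]
    constructor <;> nlinarith [sq_nonneg (f ω - ∫ ω, f ω ∂P + (g ω - ∫ ω, g ω ∂P)),
      sq_nonneg (f ω - ∫ ω, f ω ∂P - (g ω - ∫ ω, g ω ∂P))]
  have h2 := variance_le_expectation_sq hf.aestronglyMeasurable
  have h3 := variance_le_expectation_sq hg.aestronglyMeasurable
  simp only [Pi.pow_apply] at h2 h3
  linarith

theorem abs_covariance_le_of_bounded {L : ℝ} (hf : Measurable f) (hfL : ∀ ω, |f ω| ≤ L)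
    (hg : MemLp g 2 P) : |cov[f, g; P]| ≤ 2 * L * ∫ ω, |g ω| ∂P := by
  have hf2 : MemLp f 2 P := MemLp.of_bound hf.aestronglyMeasurable L (Eventually.of_forall hfL)
  have hgi : Integrable g P := hg.integrable one_le_two
  rw [covariance_eq_sub hf2 hg]
  have h1 : |∫ ω, (f * g) ω ∂P| ≤ L * ∫ ω, |g ω| ∂P := by
    rw [← integral_const_mul]
    refine abs_integral_le_integral_abs.trans
      (integral_mono (hf2.integrable_mul hg).abs (hgi.abs.const_mul L) fun ω => ?_)
    simp only [Pi.mul_apply, abs_mul]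
    exact mul_le_mul_of_nonneg_right (hfL ω) (abs_nonneg _)
  have h2 : |∫ ω, f ω ∂P| ≤ L := by
    simpa using norm_integral_le_of_norm_le_const (μ := P) (f := f) (Eventually.of_forall hfL)
  calc _ ≤ |∫ ω, (f * g) ω ∂P| + |∫ ω, f ω ∂P| * |∫ ω, g ω ∂P| := by
        rw [← abs_mul]
        exact abs_sub _ _
    _ ≤ L * ∫ ω, |g ω| ∂P + L * ∫ ω, |g ω| ∂P :=
        add_le_add h1 (mul_le_mul h2 abs_integral_le_integral_abs (abs_nonneg _)
          ((abs_nonneg _).trans h2))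
    _ = 2 * L * ∫ ω, |g ω| ∂P := by ring

/-- Covariance inequality for strongly mixing processes and variables with a fourth moment. -/
theorem HasMixingBound.abs_covariance_le {X : ℕ → Ω → ℝ} {a : ℕ → ℝ} (h : HasMixingBound X P a)
    (hX : ∀ i, Measurable (X i)) {m t : ℕ} {s : ℝ} (ha : 0 < a m) (hs : 0 < s)
    (hf : Measurable[pastSigma X t] f) (hg : Measurable[futureSigma X (t + m)] g)
    (hf4 : MemLp f 4 P) (hg4 : MemLp g 4 P) (hfs : ∫ ω, f ω ^ 4 ∂P ≤ s ^ 2)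
    (hgs : ∫ ω, g ω ^ 4 ∂P ≤ s ^ 2) : |cov[f, g; P]| ≤ 9 * s * a m := by
  -- This level balances the errors: `L² * a m ^ 2`, `L * (s² / L³)` and `s² / L²` all equal `s * a
  -- m`. The four covariances of truncated parts and tails contribute 4, 2, 2 and 1 times this.
  set L := √(s / a m) with hL
  have hL0 : 0 < L := Real.sqrt_pos.2 (div_pos hs ha)
  have hL2 : L ^ 2 = s / a m := Real.sq_sqrt (div_pos hs ha).le
  have hfm : Measurable f := hf.mono (pastSigma_le hX _) le_rfl
  have hgm : Measurable g := hg.mono (futureSigma_le hX _) le_rfl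
  have hT := measurable_truncate L
  have tail : ∀ {u : Ω → ℝ}, Measurable u → MemLp u 4 P → ∫ ω, u ω ^ 4 ∂P ≤ s ^ 2 →
      MemLp (fun ω => truncate L (u ω)) 2 P ∧ MemLp (fun ω => u ω - truncate L (u ω)) 2 P ∧
      ∫ ω, |u ω - truncate L (u ω)| ∂P ≤ s ^ 2 / L ^ 3 ∧
      ∫ ω, (u ω - truncate L (u ω)) ^ 2 ∂P ≤ s ^ 2 / L ^ 2 := by
    intro u hu hu4 hus
    have i1 : MemLp (fun ω => truncate L (u ω)) 2 P :=
      MemLp.of_bound (hT.comp hu).aestronglyMeasurable L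
        (Eventually.of_forall fun ω => abs_truncate_le hL0.le _)
    have i2 : MemLp (fun ω => u ω - truncate L (u ω)) 2 P :=
      (hu4.mono_exponent (by norm_num)).sub i1
    refine ⟨i1, i2, ?_, ?_⟩
    · calc _ ≤ ∫ ω, u ω ^ 4 / L ^ 3 ∂P :=
            integral_mono (i2.integrable one_le_two).abs ((integrable_pow_four hu4).div_const _)
              fun ω => abs_sub_truncate_le_pow hL0 _
        _ ≤ _ := by
            rw [integral_div]
            gcongr
    · calc _ ≤ ∫ ω, u ω ^ 4 / L ^ 2 ∂P :=
            integral_mono i2.integrable_sq ((integrable_pow_four hu4).div_const _)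
              fun ω => sub_truncate_sq_le_pow hL0 _
        _ ≤ _ := by
            rw [integral_div]
            gcongr
  obtain ⟨tf, rf, rf1, rf2⟩ := tail hfm hf4 hfs
  obtain ⟨tg, rg, rg1, rg2⟩ := tail hgm hg4 hgs
  set Tf := fun ω => truncate L (f ω) with hTf
  set Tg := fun ω => truncate L (g ω) with hTg
  set Rf := fun ω => f ω - truncate L (f ω) with hRf
  set Rg := fun ω => g ω - truncate L (g ω) with hRg
  have ef : f = Tf + Rf := by ext; simp [Tf, Rf]
  have eg : g = Tg + Rg := by ext; simp [Tg, Rg]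
  have bT : ∀ x, |truncate L x| ≤ L := abs_truncate_le hL0.le
  have hs2 : s ^ 2 / L ^ 2 = s * a m := by
    rw [hL2]
    field_simp
  have hs3 : L * (s ^ 2 / L ^ 3) = s * a m := by
    rw [← hs2]
    field_simp
  have c1 : |cov[Tf, Tg; P]| ≤ 4 * (s * a m) := by
    rw [covariance_eq_sub tf tg]
    refine (h.abs_integral_sub_le hX (hT.comp hf) (hT.comp hg) (fun ω => bT _)
      (fun ω => bT _)).trans_eq ?_
    rw [mul_assoc 4, ← sq, hL2]
    field_simp
  have c2 : |cov[Tf, Rg; P]| ≤ 2 * (s * a m) :=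
    (abs_covariance_le_of_bounded (hT.comp hfm) (fun ω => bT _) rg).trans (by
      rw [mul_assoc, ← hs3]
      gcongr)
  have c3 : |cov[Rf, Tg; P]| ≤ 2 * (s * a m) := by
    rw [covariance_comm]
    exact (abs_covariance_le_of_bounded (hT.comp hgm) (fun ω => bT _) rf).trans (by
      rw [mul_assoc, ← hs3]
      gcongr)
  have c4 : |cov[Rf, Rg; P]| ≤ s * a m :=
    (abs_covariance_le_half rf rg).trans (by
      rw [hs2] at rf2 rg2
      linarith)
  have e : cov[f, g; P] = cov[Tf, Tg; P] + cov[Tf, Rg; P] + (cov[Rf, Tg; P] + cov[Rf, Rg; P]) := by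
    rw [ef, eg, covariance_add_left tf rf (tg.add rg), covariance_add_right tf tg rg,
      covariance_add_right rf tg rg]
  rw [e]
  rw [abs_le] at *
  constructor <;> linarith [c1.1, c1.2, c2.1, c2.2, c3.1, c3.2, c4.1, c4.2]

end Covariance

/-! ### Double sums of covariances -/

/-- Grouping by the larger index and then by the lag turns the average over a square into a Cesàro
mean of sums over lags. -/
theorem sum_range_sum_range_eq {f : ℕ → ℕ → ℝ} (hf : ∀ i j, f i j = f j i) (n : ℕ) :
    ∑ i ∈ Finset.range n, ∑ j ∈ Finset.range n, f i j =
      ∑ j ∈ Finset.range n, (f j j + 2 * ∑ h ∈ Finset.range j, f (j - (h + 1)) j) := by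
  induction n with
  | zero => simp
  | succ n ih =>
    rw [Finset.sum_range_succ (fun j => f j j + 2 * ∑ h ∈ Finset.range j, f (j - (h + 1)) j), ← ih]
    simp only [Finset.sum_range_succ _ n, Finset.sum_add_distrib]
    have h1 : ∑ j ∈ Finset.range n, f n j = ∑ j ∈ Finset.range n, f j n :=
      Finset.sum_congr rfl fun j _ => hf n j
    have h2 : ∑ h ∈ Finset.range n, f (n - (h + 1)) n = ∑ j ∈ Finset.range n, f j n := by
      rw [← Finset.sum_range_reflect]
      refine Finset.sum_congr rfl fun j hj => ?_
      have := Finset.mem_range.1 hj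
      congr 1
      omega
    rw [h1, h2]
    ring

/-- Weighted averages of a summable sequence of covariances over a square, with weights that are
bounded and tend to one along the diagonals, converge to the sum over all lags. -/
theorem tendsto_weighted_average {w : ℕ → ℕ → ℝ} {c : ℕ → ℝ} {C : ℝ} (hw : ∀ i j, w i j = w j i)
    (hC : ∀ i j, |w i j| ≤ C) (hc : Summable c)
    (hlim : ∀ h, c h ≠ 0 → Tendsto (fun i => w i (i + h)) atTop (𝓝 1)) :
    Tendsto (fun n : ℕ => (n : ℝ)⁻¹ *
      ∑ i ∈ Finset.range n, ∑ j ∈ Finset.range n, w i j * c (Nat.dist i j)) atTop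
      (𝓝 (c 0 + 2 * ∑' h, c (h + 1))) := by
  have hlim' : ∀ h, Tendsto (fun j => w (j - h) j * c h) atTop (𝓝 (c h)) := by
    intro h
    by_cases h0 : c h = 0
    · simp [h0]
    · have h1 : Tendsto (fun j => w (j - h) j) atTop (𝓝 1) := by
        refine ((hlim h h0).comp (tendsto_sub_atTop_nat h)).congr' ?_
        filter_upwards [eventually_ge_atTop h] with j hj
        simp [Nat.sub_add_cancel hj]
      simpa using h1.mul_const (c h)
  -- For fixed lag the weight tends to one as `j` grows, and `C * |c (h + 1)|` dominates, so the sum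
  -- over lags converges.
  have key : Tendsto (fun j => w j j * c (Nat.dist j j) +
      2 * ∑ h ∈ Finset.range j, w (j - (h + 1)) j * c (Nat.dist (j - (h + 1)) j)) atTop
      (𝓝 (c 0 + 2 * ∑' h, c (h + 1))) := by
    refine Tendsto.add (by simpa using hlim' 0) (Tendsto.const_mul 2 ?_)
    have hdom := tendsto_tsum_of_dominated_convergence (𝓕 := atTop)
      (f := fun j h => if h ∈ Finset.range j then w (j - (h + 1)) j * c (h + 1) else 0)
      (g := fun h => c (h + 1)) (bound := fun h => C * |c (h + 1)|)
      (((summable_nat_add_iff 1).2 hc.abs).mul_left C) (fun h => ?_)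
      (Eventually.of_forall fun j h => ?_)
    · refine hdom.congr fun j => ?_
      rw [tsum_eq_sum (s := Finset.range j) fun h hh => if_neg hh]
      refine Finset.sum_congr rfl fun h hh => ?_
      rw [if_pos hh, Nat.dist_eq_sub_of_le (Nat.sub_le _ _), Nat.sub_sub_self]
      exact Finset.mem_range.1 hh
    · refine (hlim' (h + 1)).congr' ?_
      filter_upwards [eventually_gt_atTop h] with j hj
      rw [if_pos (Finset.mem_range.2 hj)]
    · have hC0 : 0 ≤ C := (abs_nonneg _).trans (hC 0 0)
      split_ifs
      · rw [norm_mul]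
        exact mul_le_mul_of_nonneg_right (hC _ _) (abs_nonneg _)
      · rw [norm_zero]
        positivity
  refine key.cesaro.congr fun n => ?_
  rw [sum_range_sum_range_eq fun i j => by rw [hw, Nat.dist_comm]]

theorem sum_range_sum_range_abs_le {v : ℕ → ℕ → ℝ} {C : ℕ → ℝ} (hv : ∀ i j, v i j = v j i)
    (hC : ∀ i, HasSum (fun h : ℤ => |v i (i + h.natAbs)|) (C i)) (n : ℕ) :
    ∑ i ∈ Finset.range n, ∑ j ∈ Finset.range n, |v i j| ≤ 2 * ∑ i ∈ Finset.range n, C i := by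
  have hle : ∀ i j, |v i j| ≤ (if i ≤ j then |v i j| else 0) + (if j ≤ i then |v j i| else 0) := by
    intro i j
    have := abs_nonneg (v i j)
    rw [hv j i]
    rcases le_total i j with h | h
    · rw [if_pos h]
      split_ifs <;> linarith
    · rw [if_pos h]
      split_ifs <;> linarith
  have hrow : ∀ i, ∑ j ∈ Finset.range n, (if i ≤ j then |v i j| else 0) ≤ C i := by
    intro i
    rw [← Finset.sum_filter]
    -- The column `j ≥ i` corresponds to the nonnegative lag `j - i`, so the row is part of the sum
    -- over integer lags.
    have e : ∑ j ∈ Finset.range n with i ≤ j, |v i j| =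
        ∑ h ∈ ((Finset.range n).filter (i ≤ ·)).image (fun j : ℕ => (j : ℤ) - i),
          |v i (i + h.natAbs)| := by
      rw [Finset.sum_image]
      · refine Finset.sum_congr rfl fun j hj => ?_
        have := (Finset.mem_filter.1 hj).2
        congr 2
        omega
      · intro x _ y _ hxy
        simpa using hxy
    rw [e]
    exact sum_le_hasSum _ (fun h _ => abs_nonneg _) (hC i)
  calc _ ≤ ∑ i ∈ Finset.range n, ∑ j ∈ Finset.range n,
        ((if i ≤ j then |v i j| else 0) + (if j ≤ i then |v j i| else 0)) :=
        Finset.sum_le_sum fun i _ => Finset.sum_le_sum fun j _ => hle i j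
    _ = 2 * ∑ i ∈ Finset.range n, ∑ j ∈ Finset.range n, (if i ≤ j then |v i j| else 0) := by
        simp only [Finset.sum_add_distrib]
        rw [two_mul]
        congr 1
        exact Finset.sum_comm
    _ ≤ _ := by
        gcongr with i
        exact hrow i

/-! ### The conditional variance as a quadratic form -/

/-- The normalized quadratic form on the first `n` coordinates with matrix `v`. -/
noncomputable def quadForm (v : ℕ → ℕ → ℝ) (n : ℕ) (x : ℕ → ℝ) : ℝ :=
  (n : ℝ)⁻¹ * ∑ i ∈ Finset.range n, ∑ j ∈ Finset.range n, v i j * (x i * x j)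

/-- The σ-algebra generated by the whole process. -/
abbrev processSigma {Ω : Type*} (X : ℕ → Ω → ℝ) : MeasurableSpace Ω :=
  MeasurableSpace.comap (fun ω i => X i ω) MeasurableSpace.pi

theorem indepFun_of_measurable_process {Ω : Type*} [MeasurableSpace Ω] {P : Measure Ω}
    {X V : ℕ → Ω → ℝ} (hind : IndepFun (fun ω i => X i ω) (fun ω i => V i ω) P)
    {f g : Ω → ℝ} (hf : Measurable[processSigma X] f) (hg : Measurable[processSigma V] g) :
    IndepFun f g P := by
  rw [IndepFun_iff_Indep] at hind ⊢
  exact indep_of_indep_of_le_left (indep_of_indep_of_le_right hind hg.comap_le) hf.comap_le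

theorem measurable_processSigma {Ω : Type*} (V : ℕ → Ω → ℝ) (i : ℕ) :
    Measurable[processSigma V] (V i) :=
  (measurable_pi_apply i).comp (comap_measurable (fun ω i => V i ω))

section ConditionalVariance

variable {Ω : Type*} [mΩ : MeasurableSpace Ω] {P : Measure Ω} [IsProbabilityMeasure P]
  {X V Y : ℕ → Ω → ℝ}

theorem processSigma_le (hX : ∀ i, Measurable (X i)) : processSigma X ≤ mΩ :=
  (measurable_pi_lambda _ hX).comap_le

/-- Variables that are functions of the data can be pulled out of a conditional expectation, and
variables independent of the data are replaced by their expectation. -/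
theorem condExp_mul_of_indepFun (hX : ∀ i, Measurable (X i)) (hV : ∀ i, Measurable (V i))
    (hind : IndepFun (fun ω i => X i ω) (fun ω i => V i ω) P) {f g : Ω → ℝ}
    (hf : Measurable[processSigma X] f) (hg : Measurable[processSigma V] g)
    (hfi : Integrable f P) (hgi : Integrable g P) :
    P[fun ω => f ω * g ω|processSigma X] =ᵐ[P] fun ω => f ω * ∫ x, g x ∂P := by
  have hfg : Integrable (f * g) P :=
    (indepFun_of_measurable_process hind hf hg).integrable_mul hfi hgi
  have h1 := condExp_mul_of_stronglyMeasurable_left (μ := P) hf.stronglyMeasurable hfg hgi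
  have h2 := condExp_indep_eq (processSigma_le hV) (processSigma_le hX) (μ := P)
    hg.stronglyMeasurable ((IndepFun_iff_Indep _ _ _).1 hind).symm
  filter_upwards [h1, h2] with ω h1 h2
  rw [show (fun ω => f ω * g ω) = f * g from rfl, h1, Pi.mul_apply, h2]

/-- Conditioning replaces each weight by its mean, so the deviation is the same sum with centered
weights `W`. Expanding its square, the products of data come out of the conditional expectation and
those of weights become covariances. -/
theorem condVar_weighted_sum (hX : ∀ i, Measurable (X i)) (hV : ∀ i, Measurable (V i))
    (hind : IndepFun (fun ω i => X i ω) (fun ω i => V i ω) P)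
    (hY : ∀ i, Measurable[processSigma X] (Y i)) (hY2 : ∀ i, MemLp (Y i) 2 P)
    (hV2 : ∀ i, MemLp (V i) 2 P) (n : ℕ) :
    Var[fun ω => (√(n : ℝ))⁻¹ * ∑ i ∈ Finset.range n, V i ω * Y i ω; P | processSigma X]
      =ᵐ[P] fun ω => quadForm (fun i j => cov[V i, V j; P]) n (fun i => Y i ω) := by
  set W : ℕ → Ω → ℝ := fun i ω => V i ω - ∫ x, V i x ∂P with hW
  have hWm : ∀ i, Measurable[processSigma V] (W i) := fun i =>
    (measurable_processSigma V i).sub measurable_const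
  have hW2 : ∀ i, MemLp (W i) 2 P := fun i => (hV2 i).sub (memLp_const _)
  have hfi : ∀ i, Integrable (fun ω => Y i ω * V i ω) P := fun i =>
    (indepFun_of_measurable_process hind (hY i) (measurable_processSigma V i)).integrable_mul
      ((hY2 i).integrable one_le_two) ((hV2 i).integrable one_le_two)
  have h1 : P[fun ω => (√(n : ℝ))⁻¹ * ∑ i ∈ Finset.range n, V i ω * Y i ω|processSigma X]
      =ᵐ[P] fun ω => (√(n : ℝ))⁻¹ * ∑ i ∈ Finset.range n, Y i ω * ∫ x, V i x ∂P := by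
    have e : (fun ω => (√(n : ℝ))⁻¹ * ∑ i ∈ Finset.range n, V i ω * Y i ω) =
        (√(n : ℝ))⁻¹ • ∑ i ∈ Finset.range n, fun ω => Y i ω * V i ω := by
      ext ω
      simp [mul_comm]
    rw [e]
    have hc : ∀ i, P[fun ω => Y i ω * V i ω|processSigma X] =ᵐ[P]
        fun ω => Y i ω * ∫ x, V i x ∂P := fun i =>
      condExp_mul_of_indepFun hX hV hind (hY i) (measurable_processSigma V i)
        ((hY2 i).integrable one_le_two) ((hV2 i).integrable one_le_two)
    filter_upwards [condExp_smul (μ := P) (√(n : ℝ))⁻¹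
      (∑ i ∈ Finset.range n, fun ω => Y i ω * V i ω) (processSigma X),
      condExp_finsetSum (μ := P) (s := Finset.range n) (fun i _ => hfi i) (processSigma X),
      ae_all_iff.2 hc] with ω e1 e2 e3
    rw [e1, Pi.smul_apply, e2, Finset.sum_apply, smul_eq_mul]
    simp only [e3]
  have hYY : ∀ i j, Integrable (fun ω => Y i ω * Y j ω) P := fun i j =>
    (hY2 i).integrable_mul (hY2 j)
  have hWW : ∀ i j, Integrable (fun ω => W i ω * W j ω) P := fun i j =>
    (hW2 i).integrable_mul (hW2 j)
  have hYYm : ∀ i j, Measurable[processSigma X] (fun ω => Y i ω * Y j ω) := fun i j =>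
    (hY i).mul (hY j)
  have hWWm : ∀ i j, Measurable[processSigma V] (fun ω => W i ω * W j ω) := fun i j =>
    (hWm i).mul (hWm j)
  have hYW : ∀ i j, Integrable (fun ω => Y i ω * Y j ω * (W i ω * W j ω)) P := fun i j =>
    (indepFun_of_measurable_process hind (hYYm i j) (hWWm i j)).integrable_mul (hYY i j) (hWW i j)
  have h2 : ((fun ω => (√(n : ℝ))⁻¹ * ∑ i ∈ Finset.range n, V i ω * Y i ω) -
      P[fun ω => (√(n : ℝ))⁻¹ * ∑ i ∈ Finset.range n, V i ω * Y i ω|processSigma X]) ^ 2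
      =ᵐ[P] (n : ℝ)⁻¹ • ∑ p ∈ Finset.range n ×ˢ Finset.range n,
        fun ω => Y p.1 ω * Y p.2 ω * (W p.1 ω * W p.2 ω) := by
    filter_upwards [h1] with ω h1
    simp only [Pi.pow_apply, Pi.sub_apply, h1, Pi.smul_apply, Finset.sum_apply, smul_eq_mul]
    rw [← mul_sub, mul_pow, inv_pow, Real.sq_sqrt (Nat.cast_nonneg n), ← Finset.sum_sub_distrib,
      sq, Finset.sum_mul_sum, Finset.sum_product]
    congr 1
    refine Finset.sum_congr rfl fun i _ => Finset.sum_congr rfl fun j _ => ?_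
    simp only [hW]
    ring
  refine (condExp_congr_ae h2).trans ?_
  have hc : ∀ p : ℕ × ℕ, P[fun ω => Y p.1 ω * Y p.2 ω * (W p.1 ω * W p.2 ω)|processSigma X] =ᵐ[P]
      fun ω => Y p.1 ω * Y p.2 ω * cov[V p.1, V p.2; P] := fun p =>
    condExp_mul_of_indepFun hX hV hind (hYYm p.1 p.2) (hWWm p.1 p.2) (hYY _ _) (hWW _ _)
  filter_upwards [condExp_smul (μ := P) (n : ℝ)⁻¹
      (∑ p ∈ Finset.range n ×ˢ Finset.range n,
        fun ω => Y p.1 ω * Y p.2 ω * (W p.1 ω * W p.2 ω)) (processSigma X),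
      condExp_finsetSum (μ := P) (s := Finset.range n ×ˢ Finset.range n)
        (fun p _ => hYW p.1 p.2) (processSigma X),
      ae_all_iff.2 hc] with ω e1 e2 e3
  rw [e1, Pi.smul_apply, e2, Finset.sum_apply, smul_eq_mul, quadForm]
  simp only [e3]
  rw [Finset.sum_product]
  simp only [mul_comm]

theorem quadForm_covariance_nonneg (hV2 : ∀ i, MemLp (V i) 2 P) (n : ℕ) (x : ℕ → ℝ) :
    0 ≤ quadForm (fun i j => cov[V i, V j; P]) n x := by
  have h : Var[∑ i ∈ Finset.range n, fun ω => x i * V i ω; P] =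
      ∑ i ∈ Finset.range n, ∑ j ∈ Finset.range n, cov[V i, V j; P] * (x i * x j) := by
    rw [variance_sum' fun i _ => (hV2 i).const_mul (x i)]
    refine Finset.sum_congr rfl fun i _ => Finset.sum_congr rfl fun j _ => ?_
    rw [covariance_const_mul_left, covariance_const_mul_right]
    ring
  rw [quadForm, ← h]
  exact mul_nonneg (by positivity) (variance_nonneg _ _)

end ConditionalVariance

/-- The bracket is twice the symmetrized bilinear form, expressed through `quadForm` alone. -/
theorem quadForm_mul_sub (v : ℕ → ℕ → ℝ) (n : ℕ) (s : ℝ) (x y : ℕ → ℝ) :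
    quadForm v n (fun i => s * x i - y i) = s ^ 2 * quadForm v n x -
      s * (quadForm v n x + quadForm v n y - quadForm v n (fun i => x i - y i)) +
      quadForm v n y := by
  simp only [quadForm, Finset.mul_sum, ← Finset.sum_add_distrib, ← Finset.sum_sub_distrib]
  refine Finset.sum_congr rfl fun i _ => Finset.sum_congr rfl fun j _ => ?_
  ring

/-- Perturbation bound for a nonnegative quadratic form. -/
theorem abs_quadForm_sub_le {v : ℕ → ℕ → ℝ} {n : ℕ} (hv : ∀ x, 0 ≤ quadForm v n x) (y z : ℕ → ℝ)
    {t : ℝ} (ht : 0 < t) :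
    |quadForm v n y - quadForm v n (fun i => y i - z i)| ≤
      t * quadForm v n y + (1 + t⁻¹) * quadForm v n z := by
  -- Nonnegativity at `t * y - z` and at `-t * y - z` bounds the cross term `B` from above and below
  -- by `t Q(y) + t⁻¹ Q(z)`.
  have h1 := hv (fun i => t * y i - z i)
  have h2 := hv (fun i => -t * y i - z i)
  rw [quadForm_mul_sub] at h1 h2
  have h3 := hv z
  set B := quadForm v n y + quadForm v n z - quadForm v n (fun i => y i - z i) with hB
  have e : t * (t⁻¹ * quadForm v n z) = quadForm v n z := by field_simp
  have b1 : B ≤ t * quadForm v n y + t⁻¹ * quadForm v n z :=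
    le_of_mul_le_mul_left (by linarith) ht
  have b2 : -B ≤ t * quadForm v n y + t⁻¹ * quadForm v n z :=
    le_of_mul_le_mul_left (by linarith) ht
  rw [abs_le]
  constructor <;> linarith

/-! ### A summable rate from the mixing coefficients -/

section Rate

variable {Ω : Type*} [mΩ : MeasurableSpace Ω] {P : Measure Ω} [IsProbabilityMeasure P]

theorem abs_measureReal_inter_sub_le_one (A B : Set Ω) :
    |P.real (A ∩ B) - P.real A * P.real B| ≤ 1 := by
  have h1 : P.real A * P.real B ≤ 1 := mul_le_one₀ measureReal_le_one measureReal_nonneg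
    measureReal_le_one
  have h2 : 0 ≤ P.real A * P.real B := mul_nonneg measureReal_nonneg measureReal_nonneg
  have h3 : P.real (A ∩ B) ≤ 1 := measureReal_le_one
  have h4 : 0 ≤ P.real (A ∩ B) := measureReal_nonneg
  rw [abs_le]
  constructor <;> linarith

theorem abs_sub_le_alphaMixingCoeff {X : ℕ → Ω → ℝ} {s h : ℕ} {A B : Set Ω}
    (hA : MeasurableSet[pastSigma X s] A) (hB : MeasurableSet[futureSigma X (s + h + 1)] B) :
    |P.real (A ∩ B) - P.real A * P.real B| ≤ alphaMixingCoeff X P h := by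
  refine le_csSup ⟨1, ?_⟩ ⟨s, A, B, hA, ?_, rfl⟩
  · rintro r ⟨s, A, B, -, -, rfl⟩
    exact abs_measureReal_inter_sub_le_one A B
  · have e : Set.Ioi (s + h) = Set.Ici (s + h + 1) := Set.ext fun _ => Nat.lt_iff_add_one_le
    rw [e]
    exact hB

theorem alphaMixingCoeff_nonneg {Ω : Type*} [MeasurableSpace Ω] {P : Measure Ω}
    (X : ℕ → Ω → ℝ) (h : ℕ) : 0 ≤ alphaMixingCoeff X P h := by
  refine Real.sSup_nonneg ?_
  rintro r ⟨s, A, B, -, -, rfl⟩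
  exact abs_nonneg _

theorem alphaMixingCoeff_le_one (X : ℕ → Ω → ℝ) (h : ℕ) : alphaMixingCoeff X P h ≤ 1 := by
  refine Real.sSup_le ?_ zero_le_one
  rintro r ⟨s, A, B, -, -, rfl⟩
  exact abs_measureReal_inter_sub_le_one A B

theorem alphaMixingCoeff_succ_le (X : ℕ → Ω → ℝ) (h : ℕ) :
    alphaMixingCoeff X P (h + 1) ≤ alphaMixingCoeff X P h := by
  refine Real.sSup_le ?_ (alphaMixingCoeff_nonneg X h)
  rintro r ⟨s, A, B, hA, hB, rfl⟩
  exact abs_sub_le_alphaMixingCoeff hA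
    ((biSup_mono fun i hi => Set.mem_Ici.2 (by have := Set.mem_Ioi.1 hi; omega) :
      (⨆ i ∈ Set.Ioi (s + (h + 1)), MeasurableSpace.comap (X i) inferInstance) ≤
        futureSigma X (s + h + 1)) _ hB)

theorem exists_summable_hasMixingBound {X : ℕ → Ω → ℝ}
    (hmix : Summable fun i : ℕ => alphaMixingCoeff X P (i + 1) ^ (1 / 2 : ℝ)) :
    ∃ a : ℕ → ℝ, Antitone a ∧ (∀ m, 0 < a m) ∧ Summable a ∧ HasMixingBound X P a := by
  -- The shift by one appears because the coefficient of order `h` allows futures from time `s + h +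
  -- 1` on; at gap zero the trivial bound 1 is used. The geometric term added below makes the rate
  -- strictly positive, as dividing by it in the truncation level requires.
  set b : ℕ → ℝ := fun m => if m = 0 then 1 else √(alphaMixingCoeff X P (m - 1)) with hb
  have hb0 : ∀ m, 0 ≤ b m := fun m => by
    simp only [hb]
    split_ifs <;> positivity
  have hp : ∀ m : ℕ, 0 < (1 / 2 : ℝ) ^ m := fun m => by positivity
  refine ⟨fun m => b m + (1 / 2) ^ m, antitone_nat_of_succ_le fun m => add_le_add ?_ ?_,
    fun m => add_pos_of_nonneg_of_pos (hb0 m) (hp m), ?_, ?_⟩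
  · rcases m with _ | m
    · simpa [hb] using alphaMixingCoeff_le_one (P := P) X 0
    · simpa [hb] using Real.sqrt_le_sqrt (alphaMixingCoeff_succ_le (P := P) X m)
  · exact pow_le_pow_of_le_one (by norm_num) (by norm_num) (Nat.le_succ m)
  · refine Summable.add ((summable_nat_add_iff 2).1 ?_) (summable_geometric_of_lt_one (by norm_num)
      (by norm_num))
    simpa [hb, Real.sqrt_eq_rpow] using hmix
  · intro m s A B hA hB
    have h1 : |P.real (A ∩ B) - P.real A * P.real B| ≤ b m ^ 2 := by
      rcases m with _ | m
      · simpa [hb] using abs_measureReal_inter_sub_le_one A B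
      · simpa [hb, Real.sq_sqrt (alphaMixingCoeff_nonneg X m)] using
          abs_sub_le_alphaMixingCoeff hA hB
    refine h1.trans ?_
    have := hb0 m
    have := (hp m).le
    gcongr
    linarith

end Rate

/-! ### Moments and covariances of stationary processes -/

section Stationary

variable {Ω : Type*} [mΩ : MeasurableSpace Ω] {P : Measure Ω} {X : ℕ → Ω → ℝ}

theorem IsStrictlyStationary.map_eq (h : IsStrictlyStationary X P) (hX : ∀ i, Measurable (X i))
    (i : ℕ) : P.map (X i) = P.map (X 0) := by
  have h1 := congrArg (Measure.map fun x : Fin 1 → ℝ => x 0) (h 1 (fun _ => 0) i)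
  rw [Measure.map_map (by fun_prop) (by fun_prop), Measure.map_map (by fun_prop) (by fun_prop)] at h1
  simpa [Function.comp_def] using h1.symm

theorem IsStrictlyStationary.integral_comp (h : IsStrictlyStationary X P)
    (hX : ∀ i, Measurable (X i)) {φ : ℝ → ℝ} (hφ : Measurable φ) (i : ℕ) :
    ∫ ω, φ (X i ω) ∂P = ∫ ω, φ (X 0 ω) ∂P := by
  rw [← integral_map (hX i).aemeasurable hφ.aestronglyMeasurable, h.map_eq hX i,
    integral_map (hX 0).aemeasurable hφ.aestronglyMeasurable]

theorem IsStrictlyStationary.covariance_add (h : IsStrictlyStationary X P)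
    (hX : ∀ i, Measurable (X i)) (i k : ℕ) : cov[X i, X (i + k); P] = autocov X P k := by
  have e : ∀ t : Fin 2 → ℕ, cov[X (t 0), X (t 1); P] =
      cov[fun x : Fin 2 → ℝ => x 0, fun x => x 1; P.map fun ω j => X (t j) ω] := fun t => by
    rw [covariance_map (measurable_pi_apply 0).aestronglyMeasurable
      (measurable_pi_apply 1).aestronglyMeasurable (by fun_prop)]
    rfl
  have h1 := e ![0, k]
  have h2 := e ![i, k + i]
  have h3 := h 2 ![0, k] i
  have h4 : (fun ω (j : Fin 2) => X (![0, k] j + i) ω) = fun ω j => X (![i, k + i] j) ω := by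
    ext ω j
    fin_cases j <;> simp
  rw [h4] at h3
  rw [h3, ← h2] at h1
  simpa [autocov, add_comm] using h1.symm

theorem IsStrictlyStationary.covariance_eq (h : IsStrictlyStationary X P)
    (hX : ∀ i, Measurable (X i)) (i j : ℕ) : cov[X i, X j; P] = autocov X P (Nat.dist i j) := by
  wlog hij : i ≤ j generalizing i j
  · rw [covariance_comm, Nat.dist_comm]
    exact this j i (le_of_not_ge hij)
  rw [Nat.dist_eq_sub_of_le hij, ← h.covariance_add hX i, Nat.add_sub_cancel' hij]

end Stationary

/-! ### Mean and variance of the quadratic form -/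

theorem integrable_quadForm {Ω : Type*} [MeasurableSpace Ω] {P : Measure Ω}
    {v : ℕ → ℕ → ℝ} {Z : ℕ → Ω → ℝ} (hZ : ∀ i, MemLp (Z i) 2 P) (n : ℕ) :
    Integrable (fun ω => quadForm v n fun i => Z i ω) P :=
  (integrable_finsetSum _ fun i _ => integrable_finsetSum _ fun j _ =>
    ((hZ i).integrable_mul (hZ j)).const_mul (v i j)).const_mul _

theorem tendsto_integral_sub_truncate_pow {Ω : Type*} [MeasurableSpace Ω] {P : Measure Ω}
    {f : Ω → ℝ} (hf : Measurable f) (hf4 : MemLp f 4 P) :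
    Tendsto (fun M : ℕ => ∫ ω, (f ω - truncate M (f ω)) ^ 4 ∂P) atTop (𝓝 0) := by
  rw [show (0 : ℝ) = ∫ _, (0 : ℝ) ∂P by simp]
  refine tendsto_integral_of_dominated_convergence (fun ω => f ω ^ 4)
    (fun M => ((hf.sub ((measurable_truncate M).comp hf)).pow_const 4).aestronglyMeasurable)
    (integrable_pow_four hf4) (fun M => Eventually.of_forall fun ω => ?_)
    (Eventually.of_forall fun ω => ?_)
  · rw [norm_pow, ← Even.pow_abs (by decide : Even 4) (f ω)]
    exact pow_le_pow_left₀ (norm_nonneg _) (abs_sub_truncate_le (Nat.cast_nonneg M) _) 4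
  · refine tendsto_const_nhds.congr' ?_
    obtain ⟨N, hN⟩ := exists_nat_ge |f ω|
    filter_upwards [eventually_ge_atTop N] with M hM
    rw [truncate_of_abs_le (hN.trans (Nat.cast_le.2 hM)), sub_self, zero_pow four_ne_zero]

section QuadForm

variable {Ω : Type*} [mΩ : MeasurableSpace Ω] {P : Measure Ω} [IsProbabilityMeasure P]
  {X : ℕ → Ω → ℝ} {v : ℕ → ℕ → ℝ} {a : ℕ → ℝ} {C : ℝ}

theorem memLp_sub_integral {Z : ℕ → Ω → ℝ} (hZ : ∀ i, MemLp (Z i) 2 P) (i : ℕ) :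
    MemLp (fun ω => Z i ω - ∫ x, Z i x ∂P) 2 P :=
  (hZ i).sub (memLp_const _)

theorem integral_quadForm {Z : ℕ → Ω → ℝ} (hZ : ∀ i, MemLp (Z i) 2 P) (n : ℕ) :
    ∫ ω, quadForm v n (fun i => Z i ω - ∫ x, Z i x ∂P) ∂P =
      (n : ℝ)⁻¹ * ∑ i ∈ Finset.range n, ∑ j ∈ Finset.range n, v i j * cov[Z i, Z j; P] := by
  have hi : ∀ i j, Integrable
      (fun ω => v i j * ((Z i ω - ∫ x, Z i x ∂P) * (Z j ω - ∫ x, Z j x ∂P))) P := fun i j =>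
    ((memLp_sub_integral hZ i).integrable_mul (memLp_sub_integral hZ j)).const_mul (v i j)
  simp only [quadForm]
  rw [integral_const_mul, integral_finsetSum _ fun i _ => integrable_finsetSum _ fun j _ => hi i j]
  congr 1
  refine Finset.sum_congr rfl fun i _ => ?_
  rw [integral_finsetSum _ fun j _ => hi i j]
  refine Finset.sum_congr rfl fun j _ => ?_
  rw [integral_const_mul, covariance]

/-- The expected quadratic form of a function of a strongly mixing process is bounded by its fourth
moments. -/
theorem HasMixingBound.integral_quadForm_le (h : HasMixingBound X P a)
    (hX : ∀ i, Measurable (X i)) (ha0 : ∀ m, 0 < a m) (hs : Summable a)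
    (hC : ∀ i j, |v i j| ≤ C) {s : ℝ} (hs0 : 0 < s)
    (hX4 : ∀ i, MemLp (X i) 4 P) (hXs : ∀ i, ∫ ω, X i ω ^ 4 ∂P ≤ s ^ 2) (n : ℕ) :
    ∫ ω, quadForm v n (fun i => X i ω - ∫ x, X i x ∂P) ∂P ≤ 18 * C * (∑' m, a m) * s := by
  have hC0 : 0 ≤ C := (abs_nonneg _).trans (hC 0 0)
  have hcov : ∀ i j, |cov[X i, X j; P]| ≤ 9 * s * a (Nat.dist j i) := by
    intro i j
    wlog hij : i ≤ j generalizing i j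
    · rw [covariance_comm, Nat.dist_comm]
      exact this j i (le_of_not_ge hij)
    · rw [Nat.dist_eq_sub_of_le_right hij]
      exact h.abs_covariance_le hX (ha0 _) hs0 (measurable_pastSigma le_rfl)
        (measurable_futureSigma (by omega)) (hX4 i) (hX4 j) (hXs i) (hXs j)
  rw [integral_quadForm fun i => (hX4 i).mono_exponent (by norm_num)]
  have hA : 0 ≤ ∑' m, a m := tsum_nonneg fun m => (ha0 m).le
  have hrow : ∀ i, ∑ j ∈ Finset.range n, v i j * cov[X i, X j; P] ≤
      18 * C * (∑' m, a m) * s := by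
    intro i
    calc _ ≤ ∑ j ∈ Finset.range n, C * (9 * s * a (Nat.dist j i)) := by
          refine Finset.sum_le_sum fun j _ => (le_abs_self _).trans ?_
          rw [abs_mul]
          exact mul_le_mul (hC i j) (hcov i j) (abs_nonneg _) hC0
      _ = C * (9 * s * ∑ j ∈ Finset.range n, a (Nat.dist j i)) := by
          rw [← Finset.mul_sum, ← Finset.mul_sum]
      _ ≤ C * (9 * s * (2 * ∑' m, a m)) := by
          gcongr
          exact sum_range_dist_le (fun m => (ha0 m).le) hs n i
      _ = _ := by ring
  calc _ ≤ (n : ℝ)⁻¹ * ∑ i ∈ Finset.range n, 18 * C * (∑' m, a m) * s := by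
        gcongr with i
        exact hrow i
    _ = ((n : ℝ)⁻¹ * n) * (18 * C * (∑' m, a m) * s) := by
        rw [Finset.sum_const, Finset.card_range, nsmul_eq_mul, ← mul_assoc]
    _ ≤ 1 * (18 * C * (∑' m, a m) * s) := by
        gcongr
        exact inv_mul_le_one
    _ = _ := one_mul _

/-- The variance of the quadratic form of a bounded centered strongly mixing process. -/
theorem HasMixingBound.variance_quadForm_le {U : ℕ → Ω → ℝ} {K : ℝ} (h : HasMixingBound U P a)
    (hU : ∀ i, Measurable (U i)) (hK1 : 1 ≤ K) (hK : ∀ i ω, |U i ω| ≤ K)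
    (h0 : ∀ i, ∫ ω, U i ω ∂P = 0) (ha : Antitone a) (ha0 : ∀ m, 0 ≤ a m) (hs : Summable a)
    (hC : ∀ i j, |v i j| ≤ C) (n : ℕ) :
    Var[fun ω => quadForm v n fun i => U i ω; P] ≤ C * (576 * K ^ 7 * (∑' m, a m) ^ 2) *
      ((n : ℝ)⁻¹ ^ 2 * ∑ i ∈ Finset.range n, ∑ j ∈ Finset.range n, |v i j|) := by
  have hC0 : 0 ≤ C := (abs_nonneg _).trans (hC 0 0)
  set D := 576 * K ^ 7 * (∑' m, a m) ^ 2 with hD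
  set S := Finset.range n ×ˢ Finset.range n with hS
  set F : ℕ × ℕ → Ω → ℝ := fun p ω => v p.1 p.2 * (U p.1 ω * U p.2 ω) with hF
  have hF2 : ∀ p, MemLp (F p) 2 P := fun p => (memLp_mul_of_bounded hU hK p.1 p.2).const_mul _
  have e : (fun ω => quadForm v n fun i => U i ω) = fun ω => (n : ℝ)⁻¹ * (∑ p ∈ S, F p) ω := by
    ext ω
    rw [Finset.sum_apply, hS, Finset.sum_product, quadForm]
  rw [e, variance_const_mul, variance_sum' fun p _ => hF2 p]
  -- Only the weight of the second pair is bounded by `C`. Keeping `|v p.1 p.2|` leaves the sum that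
  -- the row condition controls.
  have hrow : ∀ p, ∑ q ∈ S, cov[F p, F q; P] ≤ C * D * |v p.1 p.2| := by
    intro p
    calc _ ≤ ∑ q ∈ S, |v p.1 p.2| * (C *
          |cov[fun ω => U p.1 ω * U p.2 ω, fun ω => U q.1 ω * U q.2 ω; P]|) := by
          refine Finset.sum_le_sum fun q _ => (le_abs_self _).trans ?_
          simp only [hF]
          rw [covariance_const_mul_left, covariance_const_mul_right, abs_mul, abs_mul]
          gcongr
          exact hC _ _
      _ ≤ |v p.1 p.2| * (C * D) := by
          rw [← Finset.mul_sum, ← Finset.mul_sum, hS, Finset.sum_product]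
          gcongr
          exact h.sum_abs_covariance_mul_mul_le hU hK1 hK h0 ha ha0 hs p.1 p.2 n
      _ = _ := by ring
  calc _ ≤ (n : ℝ)⁻¹ ^ 2 * ∑ p ∈ S, C * D * |v p.1 p.2| := by
        gcongr with p
        exact hrow p
    _ = _ := by
        rw [← Finset.mul_sum, hS, Finset.sum_product]
        ring

theorem integral_abs_sub_integral_le {g : Ω → ℝ} (hg : MemLp g 2 P) {ε : ℝ} (hε : 0 < ε) :
    ∫ ω, |g ω - ∫ x, g x ∂P| ∂P ≤ ε + ε⁻¹ * Var[g; P] := by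
  have hg' : MemLp (fun ω => g ω - ∫ x, g x ∂P) 2 P := hg.sub (memLp_const (∫ x, g x ∂P))
  rw [variance_eq_integral hg.aemeasurable, ← integral_const_mul]
  have e : ε = ∫ _, ε ∂P := by simp
  nth_rw 1 [e]
  rw [← integral_add (integrable_const _) (hg'.integrable_sq.const_mul _)]
  refine integral_mono (hg'.integrable one_le_two).abs
    ((integrable_const _).add (hg'.integrable_sq.const_mul _)) fun ω => ?_
  simp only
  set x := g ω - ∫ x, g x ∂P
  -- Completing the square gives `|x| ≤ ε / 4 + ε⁻¹ * x ^ 2`.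
  have h1 : 0 ≤ ε⁻¹ * (|x| - ε / 2) ^ 2 := by positivity
  have h2 : ε⁻¹ * (|x| - ε / 2) ^ 2 = ε⁻¹ * x ^ 2 - |x| + ε / 4 := by
    rw [sub_sq, sq_abs]
    field_simp
    ring
  linarith

end QuadForm

/-! ### Convergence in mean and conclusion -/

section Main

variable {Ω : Type*} [mΩ : MeasurableSpace Ω] {P : Measure Ω} [IsProbabilityMeasure P]
  {X : ℕ → Ω → ℝ} {v : ℕ → ℕ → ℝ} {a : ℕ → ℝ} {C : ℝ}

/-- The truncated process has an asymptotically deterministic quadratic form. -/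
theorem tendsto_integral_abs_quadForm_truncate (h : HasMixingBound X P a)
    (hX : ∀ i, Measurable (X i)) (ha : Antitone a) (ha0 : ∀ m, 0 < a m) (hs : Summable a)
    (hC : ∀ i j, |v i j| ≤ C)
    (hv : Tendsto (fun n : ℕ => (n : ℝ)⁻¹ ^ 2 *
      ∑ i ∈ Finset.range n, ∑ j ∈ Finset.range n, |v i j|) atTop (𝓝 0))
    {M : ℝ} (hM : 0 ≤ M) {U : ℕ → Ω → ℝ} {c : ℝ} (hU : ∀ i ω, U i ω = truncate M (X i ω) - c)
    (h0 : ∀ i, ∫ ω, U i ω ∂P = 0) :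
    Tendsto (fun n : ℕ => ∫ ω, |quadForm v n (fun i => U i ω) -
      ∫ ω', quadForm v n (fun i => U i ω') ∂P| ∂P) atTop (𝓝 0) := by
  have hUm : ∀ i, Measurable (U i) := fun i => by
    rw [show U i = fun ω => truncate M (X i ω) - c from funext (hU i)]
    exact ((measurable_truncate M).comp (hX i)).sub_const c
  have hUmix : HasMixingBound U P a := by
    have := h.comp ((measurable_truncate M).sub_const c)
    rwa [show U = fun i ω => truncate M (X i ω) - c from funext fun i => funext (hU i)]
  set K := max 1 (M + |c|) with hKdef
  have hK : ∀ i ω, |U i ω| ≤ K := fun i ω => by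
    rw [hU]
    exact (abs_sub _ _).trans ((add_le_add_left (abs_truncate_le hM _) _).trans (le_max_right _ _))
  have hq : ∀ n, MemLp (fun ω => quadForm v n fun i => U i ω) 2 P := fun n =>
    (memLp_finsetSum _ fun i _ => memLp_finsetSum _ fun j _ =>
      (memLp_mul_of_bounded hUm hK i j).const_mul (v i j)).const_mul _
  have hvar : Tendsto (fun n : ℕ => Var[fun ω => quadForm v n fun i => U i ω; P]) atTop (𝓝 0) := by
    refine squeeze_zero (fun n => variance_nonneg _ _) (fun n => hUmix.variance_quadForm_le hUm
      (le_max_left _ _) hK h0 ha (fun m => (ha0 m).le) hs hC n) ?_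
    simpa using hv.const_mul (C * (576 * K ^ 7 * (∑' m, a m) ^ 2))
  rw [Metric.tendsto_atTop]
  intro ε hε
  have hε2 : 0 < ε / 2 := half_pos hε
  have h1 := hvar.const_mul (ε / 2)⁻¹
  rw [mul_zero] at h1
  obtain ⟨N, hN⟩ := eventually_atTop.1 (h1.eventually_lt_const hε2)
  refine ⟨N, fun n hn => ?_⟩
  rw [Real.dist_0_eq_abs, abs_of_nonneg (integral_nonneg fun _ => abs_nonneg _)]
  have := integral_abs_sub_integral_le (hq n) hε2
  have := hN n hn
  linarith

/-- Convergence in mean of the quadratic form of a strongly mixing stationary process to the limit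
of its expectations. -/
theorem tendsto_integral_abs_quadForm_sub (hstat : IsStrictlyStationary X P)
    (h : HasMixingBound X P a)
    (hX : ∀ i, Measurable (X i)) (ha : Antitone a) (ha0 : ∀ m, 0 < a m) (hs : Summable a)
    (hX4 : ∀ i, MemLp (X i) 4 P) (hC : ∀ i j, |v i j| ≤ C) (hpos : ∀ n x, 0 ≤ quadForm v n x)
    (hv : Tendsto (fun n : ℕ => (n : ℝ)⁻¹ ^ 2 *
      ∑ i ∈ Finset.range n, ∑ j ∈ Finset.range n, |v i j|) atTop (𝓝 0)) {σsq : ℝ}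
    (hlim : Tendsto (fun n : ℕ => ∫ ω, quadForm v n (fun i => X i ω - ∫ x, X 0 x ∂P) ∂P) atTop
      (𝓝 σsq)) :
    Tendsto (fun n : ℕ => ∫ ω, |quadForm v n (fun i => X i ω - ∫ x, X 0 x ∂P) - σsq| ∂P) atTop
      (𝓝 0) := by
  have hC0 : 0 ≤ C := (abs_nonneg _).trans (hC 0 0)
  have hmean : ∀ {φ : ℝ → ℝ}, Measurable φ → ∀ i, ∫ ω, φ (X i ω) ∂P = ∫ ω, φ (X 0 ω) ∂P :=
    fun hφ i => hstat.integral_comp hX hφ i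
  set B := 18 * C * ∑' m, a m with hB
  have hB0 : 0 ≤ B := mul_nonneg (by positivity) (tsum_nonneg fun m => (ha0 m).le)
  set μ := ∫ x, X 0 x ∂P with hμ
  obtain ⟨s₀, hs₀, hs₀'⟩ : ∃ s : ℝ, 0 < s ∧ ∫ ω, X 0 ω ^ 4 ∂P ≤ s ^ 2 := by
    have h4 : 0 ≤ ∫ ω, X 0 ω ^ 4 ∂P := integral_nonneg fun _ => by positivity
    exact ⟨1 + ∫ ω, X 0 ω ^ 4 ∂P, by positivity, by nlinarith⟩
  have hEY : ∀ n, ∫ ω, quadForm v n (fun i => X i ω - μ) ∂P ≤ B * s₀ := fun n => by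
    have := h.integral_quadForm_le hX ha0 hs hC hs₀ hX4
      (fun i => (hmean (measurable_id.pow_const 4) i).trans_le hs₀') n
    have e : ∀ i, ∫ ω, X i ω ∂P = μ := fun i => hmean measurable_id i
    simpa only [e] using this
  rw [Metric.tendsto_atTop]
  intro ε hε
  -- The final estimate adds errors `2 * δ`, `δ`, `2 * δ` and `δ`. First `t` makes the part `t Q(Y)`
  -- of the perturbation bound small in mean; then `s`, depending on `t`, does so for `(1 + t⁻¹)
  -- Q(Z)`, and `M` is chosen for `s`.
  set δ := ε / 8 with hδ
  have hδ0 : 0 < δ := by positivity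
  set t := δ / (B * s₀ + 1) with ht
  have ht0 : 0 < t := by positivity
  have ht1 : t * (B * s₀) ≤ δ := by
    rw [ht, div_mul_eq_mul_div, div_le_iff₀ (by positivity)]
    nlinarith
  set s := δ / ((1 + t⁻¹) * B + 1) with hsdef
  have hs0 : 0 < s := by positivity
  have hs1 : (1 + t⁻¹) * (B * s) ≤ δ := by
    rw [hsdef, ← mul_assoc, mul_div_assoc', div_le_iff₀ (by positivity)]
    nlinarith
  obtain ⟨M, hM⟩ := ((tendsto_integral_sub_truncate_pow (hX 0) (hX4 0)).eventually_lt_const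
    (pow_pos hs0 2)).exists
  have hTm := measurable_truncate (M : ℝ)
  set τ := ∫ x, truncate M (X 0 x) ∂P with hτ
  have hRm : Measurable fun x : ℝ => x - truncate M x := measurable_id.sub hTm
  have hT4 : ∀ i, MemLp (fun ω => truncate M (X i ω)) 4 P := fun i =>
    MemLp.of_bound (hTm.comp (hX i)).aestronglyMeasurable M
      (Eventually.of_forall fun ω => abs_truncate_le (Nat.cast_nonneg M) _)
  have h42 : ∀ {f : Ω → ℝ}, MemLp f 4 P → MemLp f 2 P := fun hf => hf.mono_exponent (by norm_num)
  have hEZ : ∀ n, ∫ ω, quadForm v n (fun i => (X i ω - truncate M (X i ω)) - (μ - τ)) ∂P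
      ≤ B * s := fun n => by
    have hR4 : ∀ i, MemLp (fun ω => X i ω - truncate M (X i ω)) 4 P := fun i => (hX4 i).sub (hT4 i)
    have := (h.comp hRm).integral_quadForm_le (fun i => hRm.comp (hX i)) ha0 hs hC hs0 hR4
      (fun i => (hmean (hRm.pow_const 4) i).trans_le hM.le) n
    have e : ∀ i, ∫ ω, X i ω - truncate M (X i ω) ∂P = μ - τ := fun i => by
      rw [hmean hRm i, integral_sub ((hX4 0).integrable (by norm_num))
        ((hT4 0).integrable (by norm_num))]
    simpa only [e] using this
  set Y : ℕ → Ω → ℝ := fun i ω => X i ω - μ with hY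
  set Z : ℕ → Ω → ℝ := fun i ω => X i ω - truncate M (X i ω) - (μ - τ) with hZ
  set U : ℕ → Ω → ℝ := fun i ω => Y i ω - Z i ω with hU
  have hUT : ∀ i ω, U i ω = truncate M (X i ω) - τ := fun i ω => by
    simp only [hU, hY, hZ]
    ring
  have hU0 : ∀ i, ∫ ω, U i ω ∂P = 0 := fun i => by
    simp only [hUT]
    rw [integral_sub ((hT4 i).integrable (by norm_num)) (integrable_const _), hmean hTm i]
    simp [hτ]
  have hY2 : ∀ i, MemLp (Y i) 2 P := fun i => (h42 (hX4 i)).sub (memLp_const _)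
  have hZ2 : ∀ i, MemLp (Z i) 2 P := fun i =>
    ((h42 (hX4 i)).sub (h42 (hT4 i))).sub (memLp_const _)
  have hU2 : ∀ i, MemLp (U i) 2 P := fun i => (hY2 i).sub (hZ2 i)
  have hqY := integrable_quadForm (v := v) hY2
  have hqZ := integrable_quadForm (v := v) hZ2
  have hqU := integrable_quadForm (v := v) hU2
  have hYU : ∀ n, ∫ ω, |quadForm v n (fun i => Y i ω) - quadForm v n (fun i => U i ω)| ∂P
      ≤ 2 * δ := fun n => by
    calc _ ≤ ∫ ω, (t * quadForm v n (fun i => Y i ω) +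
          (1 + t⁻¹) * quadForm v n (fun i => Z i ω)) ∂P :=
          integral_mono ((hqY n).sub (hqU n)).abs
            (((hqY n).const_mul _).add ((hqZ n).const_mul _))
            fun ω => abs_quadForm_sub_le (hpos n) _ _ ht0
      _ = t * ∫ ω, quadForm v n (fun i => Y i ω) ∂P +
          (1 + t⁻¹) * ∫ ω, quadForm v n (fun i => Z i ω) ∂P := by
          rw [integral_add ((hqY n).const_mul _) ((hqZ n).const_mul _), integral_const_mul,
            integral_const_mul]
      _ ≤ t * (B * s₀) + (1 + t⁻¹) * (B * s) := by
          gcongr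
          · exact hEY n
          · exact hEZ n
      _ ≤ 2 * δ := by linarith
  have hUU := tendsto_integral_abs_quadForm_truncate h hX ha ha0 hs hC hv (Nat.cast_nonneg M)
    hUT hU0
  obtain ⟨N, hN⟩ := eventually_atTop.1 ((hUU.eventually_lt_const hδ0).and
    (Metric.tendsto_nhds.1 hlim δ hδ0))
  refine ⟨N, fun n hn => ?_⟩
  obtain ⟨hN1, hN2⟩ := hN n hn
  rw [Real.dist_0_eq_abs, abs_of_nonneg (integral_nonneg fun _ => abs_nonneg _)]
  rw [Real.dist_eq] at hN2
  set EY := ∫ ω, quadForm v n (fun i => Y i ω) ∂P with hEYdef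
  set EU := ∫ ω, quadForm v n (fun i => U i ω) ∂P with hEUdef
  have hE : |EU - EY| ≤ 2 * δ := by
    rw [abs_sub_comm, ← integral_sub (hqY n) (hqU n)]
    exact abs_integral_le_integral_abs.trans (hYU n)
  calc ∫ ω, |quadForm v n (fun i => Y i ω) - σsq| ∂P
      ≤ ∫ ω, (|quadForm v n (fun i => Y i ω) - quadForm v n (fun i => U i ω)| +
          |quadForm v n (fun i => U i ω) - EU| + (|EU - EY| + |EY - σsq|)) ∂P := by
        refine integral_mono ((hqY n).sub (integrable_const _)).abs
          ((((hqY n).sub (hqU n)).abs.add ((hqU n).sub (integrable_const _)).abs).add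
            (integrable_const _)) fun ω => ?_
        have h1 := abs_sub_le (quadForm v n (fun i => Y i ω)) (quadForm v n (fun i => U i ω)) σsq
        have h2 := abs_sub_le (quadForm v n (fun i => U i ω)) EU σsq
        have h3 := abs_sub_le EU EY σsq
        simp only
        linarith
    _ = ∫ ω, |quadForm v n (fun i => Y i ω) - quadForm v n (fun i => U i ω)| ∂P +
          ∫ ω, |quadForm v n (fun i => U i ω) - EU| ∂P + (|EU - EY| + |EY - σsq|) := by
        have i1 : Integrable (fun ω => |quadForm v n (fun i => Y i ω) -
            quadForm v n (fun i => U i ω)|) P := ((hqY n).sub (hqU n)).abs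
        have i2 : Integrable (fun ω => |quadForm v n (fun i => U i ω) - EU|) P :=
          ((hqU n).sub (integrable_const _)).abs
        have i3 : Integrable (fun ω => |quadForm v n (fun i => Y i ω) -
            quadForm v n (fun i => U i ω)| + |quadForm v n (fun i => U i ω) - EU|) P := i1.add i2
        rw [integral_add i3 (integrable_const _), integral_add i1 i2]
        simp
    _ < ε := by
        have := hYU n
        linarith

theorem tendstoInMeasure_of_tendsto_integral_abs {f : ℕ → Ω → ℝ} {c : ℝ}
    (hf : ∀ n, Integrable (f n) P)
    (h : Tendsto (fun n => ∫ ω, |f n ω - c| ∂P) atTop (𝓝 0)) :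
    TendstoInMeasure P f atTop (fun _ => c) := by
  refine tendstoInMeasure_of_tendsto_eLpNorm one_ne_zero (fun n => (hf n).aestronglyMeasurable)
    aestronglyMeasurable_const ?_
  have h' := ENNReal.tendsto_ofReal h
  rw [ENNReal.ofReal_zero] at h'
  refine h'.congr fun n => ?_
  rw [eLpNorm_one_eq_lintegral_enorm]
  exact ofReal_integral_norm_eq_lintegral_enorm ((hf n).sub (integrable_const c))

end Main

/-- Sequences are enumerated from `0`: the `i`-th term here is the term of index `i + 1` in a
sequence enumerated from `1`. -/
theorem mainTheorem6 {Ω : Type*} [MeasurableSpace Ω] (P : Measure Ω) [IsProbabilityMeasure P]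
    (X V : ℕ → Ω → ℝ)
    (hXmeas : ∀ i, Measurable (X i)) (hVmeas : ∀ i, Measurable (V i))
    -- the data are strictly stationary with finite eighth moments and summable autocovariances
    (hstat : IsStrictlyStationary X P)
    (hX8 : ∀ i, MemLp (X i) 8 P)
    (hcov : Summable fun h : ℤ => |autocov X P h.natAbs|)
    -- the mixing rate
    (hmix : Summable fun i : ℕ => alphaMixingCoeff X P (i + 1) ^ (1 / 2 : ℝ))
    -- the weights are square integrable and independent of the data
    (hV2 : ∀ i, MemLp (V i) 2 P)
    (hindep : IndepFun (fun ω i => X i ω) (fun ω i => V i ω) P)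
    -- the covariances of the weights are bounded
    (hbdd : ∃ C : ℝ, ∀ i j, |cov[V i, V j; P]| ≤ C)
    -- they tend to one at fixed lags, at a controlled rate
    (hrate : ∀ ε : ℝ, 0 < ε → ∃ N : ℕ → ℝ,
      (∀ h : ℕ, autocov X P h ≠ 0 →
        ∀ i : ℕ, N h ≤ (i : ℝ) + 1 → |1 - cov[V i, V (i + h); P]| ≤ ε) ∧
      Tendsto (fun n : ℕ => (1 / (n : ℝ)) *
        ∑ h ∈ Finset.Icc (-(n : ℤ)) (n : ℤ), N h.natAbs * |autocov X P h.natAbs|) atTop (𝓝 0))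
    -- and their absolute row sums are finite, with controlled growth
    (hrow : ∃ C : ℕ → ℝ,
      (∀ i, HasSum (fun h : ℤ => |cov[V i, V (i + h.natAbs); P]|) (C i)) ∧
      Tendsto (fun n : ℕ => (1 / (n : ℝ) ^ 2) * ∑ i ∈ Finset.range n, C i) atTop (𝓝 0)) :
    ∃ σsq : ℝ,
      Tendsto (fun n : ℕ => Var[fun ω => (√(n : ℝ))⁻¹ * ∑ i ∈ Finset.range n, X i ω; P])
        atTop (𝓝 σsq) ∧
      TendstoInMeasure P (fun n : ℕ => bootstrapVariance X V P n) atTop (fun _ => σsq) := by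

  have h42 : ∀ i, MemLp (X i) 4 P := fun i => (hX8 i).mono_exponent (by norm_num)
  have hX2 : ∀ i, MemLp (X i) 2 P := fun i => (hX8 i).mono_exponent (by norm_num)
  obtain ⟨a, ha, ha0, hs, hbound⟩ := exists_summable_hasMixingBound hmix
  obtain ⟨C, hC⟩ := hbdd
  obtain ⟨R, hR, hRlim⟩ := hrow
  have hc : Summable (autocov X P) := by
    have := hcov.comp_injective Nat.cast_injective
    exact Summable.of_abs (by simpa [Function.comp_def] using this)
  have hmean : ∀ i, ∫ ω, X i ω ∂P = ∫ ω, X 0 ω ∂P := fun i =>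
    hstat.integral_comp hXmeas measurable_id i
  refine ⟨autocov X P 0 + 2 * ∑' h, autocov X P (h + 1), ?_, ?_⟩
  -- With unit weights the average over the square is the variance of the normalized sum; the
  -- bootstrap weights below lead to the same limit.
  · refine (tendsto_weighted_average (w := fun _ _ => 1) (C := 1) (fun _ _ => rfl) (by simp) hc
      (fun _ _ => tendsto_const_nhds)).congr fun n => ?_
    rw [variance_const_mul, variance_fun_sum' fun i _ => hX2 i, inv_pow,
      Real.sq_sqrt (Nat.cast_nonneg n)]
    simp only [one_mul, hstat.covariance_eq hXmeas]
  · have hw : ∀ h, autocov X P h ≠ 0 →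
        Tendsto (fun i => cov[V i, V (i + h); P]) atTop (𝓝 1) := by
      intro h hh
      rw [Metric.tendsto_atTop]
      intro ε hε
      obtain ⟨N, hN, -⟩ := hrate (ε / 2) (half_pos hε)
      obtain ⟨m, hm⟩ := exists_nat_ge (N h)
      refine ⟨m, fun i hi => ?_⟩
      have hmi : (m : ℝ) ≤ i := Nat.cast_le.2 hi
      rw [Real.dist_eq, abs_sub_comm]
      exact (hN h hh i (by linarith)).trans_lt (half_lt_self hε)
    have hv : Tendsto (fun n : ℕ => (n : ℝ)⁻¹ ^ 2 * ∑ i ∈ Finset.range n,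
        ∑ j ∈ Finset.range n, |cov[V i, V j; P]|) atTop (𝓝 0) := by
      have h2 := hRlim.const_mul 2
      rw [mul_zero] at h2
      refine squeeze_zero (fun n => by positivity) (fun n => ?_) h2
      have h3 := sum_range_sum_range_abs_le (v := fun i j => cov[V i, V j; P])
        (fun i j => covariance_comm _ _) hR n
      calc _ ≤ (n : ℝ)⁻¹ ^ 2 * (2 * ∑ i ∈ Finset.range n, R i) := by gcongr
        _ = _ := by
          rw [one_div, inv_pow]
          ring
    have hlim := (tendsto_weighted_average (w := fun i j => cov[V i, V j; P])
      (fun i j => covariance_comm _ _) hC hc hw)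
    have hE : ∀ n : ℕ, ∫ ω, quadForm (fun i j => cov[V i, V j; P]) n
        (fun i => X i ω - ∫ x, X 0 x ∂P) ∂P = (n : ℝ)⁻¹ * ∑ i ∈ Finset.range n,
        ∑ j ∈ Finset.range n, cov[V i, V j; P] * autocov X P (Nat.dist i j) := fun n => by
      have := integral_quadForm (v := fun i j => cov[V i, V j; P]) hX2 n
      simpa only [hmean, hstat.covariance_eq hXmeas] using this
    have hY2 : ∀ i, MemLp (fun ω => X i ω - ∫ x, X 0 x ∂P) 2 P := fun i =>
      (hX2 i).sub (memLp_const _)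
    refine (tendstoInMeasure_of_tendsto_integral_abs (fun n => integrable_quadForm hY2 n)
      (tendsto_integral_abs_quadForm_sub hstat hbound hXmeas ha ha0 hs h42 hC
        (quadForm_covariance_nonneg hV2) hv (hlim.congr fun n => (hE n).symm))).congr_left
      fun n => ?_
    exact (condVar_weighted_sum hXmeas hVmeas hindep
      (fun i => (measurable_processSigma X i).sub measurable_const) hY2 hV2 n).symm
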